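/- Let $V=\{0,\dots,n-1\}$ with $n\ge 2$, and write $\log$ for the natural logarithm. \emph{Trees.} A hierarchical clustering (HC) tree on $V$ is a rooted binary tree whose nodes carry vertex sets: the root carries $V$, an internal node carries the disjoint union of the nonempty sets carried by its two children, and the leaves carry the singletons. A partial HC tree is defined in the same way, except that each leaf carries either a singleton or a \emph{super-vertex}, a nonempty set of at most $50000\log n$ vertices. The LCA of a nonempty set $X\subseteq V$ in a tree is the lowest node whose set contains $X$, and $X$ induces a maximal subtree if the LCA of $X$ carries exactly $X$. A partial HC tree $\mathcal I$ is \emph{strongly consistent} with an HC tree $\mathcal T$ if (1) each super-vertex of $\mathcal I$ induces a maximal subtree of $\mathcal T$, and (2) for any two leaves of $\mathcal I$ with sets $X$ and $Y$, the LCA of the two leaves in $\mathcal I$ carries exactly the same set as the LCA of $X\cup Y$ in $\mathcal T$. \emph{Oracle.} In an HC tree $\mathcal T$, a vertex $w$ splits away from $(u,v)$ if the LCA of $\{w,u\}$ and the LCA of $\{w,v\}$ are both equal to the LCA of $\{u,v,w\}$. A splitting oracle for $\mathcal T$ is a random function that assigns to each unordered triplet of distinct vertices one fixed vertex of the triplet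 (a repeated query gets the same answer). The events that it is correct are independent over the triplets, each of probability $9/10$; on that event the answer is the vertex that splits away from the two others in $\mathcal T$, and otherwise it is an arbitrary vertex of the triplet, chosen by an adversary who may know the tree and the outcome of all randomness of the oracle, but not the coins of the algorithm. \emph{Algorithms.} An algorithm is one randomized word RAM program with words of $\Theta(\log n)$ bits, whose input is $n$ only. An arithmetic operation on words, a memory access, a comparison, the draw of a uniformly random element of $\{0,\dots,m-1\}$ for a word $m$, and an oracle query take one unit of time each. Space is the number of bits of the memory used, which includes the output, a partial HC tree stored in the memory by pointers. \textbf{Theorem.} There are a program and an absolute constant $C$ such that for every $n\ge 2$: (i) for every oracle function and for all outcomes of the coins, the program halts within $C n^3\log n$ steps, makes at most $C n^3$ oracle queries, and uses at most $C n\log n$ bits of space; (ii) for every HC tree $\mathcal T^*$ on $V$ (in particular, for an optimal HC tree of any weighted undirected graph on $V$, for Dasgupta's, the Moseley--Wang or any other objective) and every splitting oracle for $\mathcal T^*$, with probability at least $1-1/n$ over the oracle and the coins, the program outputs a partial HC tree that is strongly consistent with $\mathcal T^*$. -/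

import Mathlib

open MeasureTheory ProbabilityTheory
open scoped ENNReal

namespace HC

/-! ## Hierarchical clustering trees -/

/-- Rooted binary trees whose leaves carry sets of vertices of `V = Fin n`. -/
inductive ClusterTree (n : ℕ) : Type
  | leaf (S : Finset (Fin n)) : ClusterTree n
  | node (l r : ClusterTree n) : ClusterTree n

namespace ClusterTree

variable {n : ℕ}

/-- The set of vertices below the root of a tree. -/
def verts : ClusterTree n → Finset (Fin n)
  | leaf S => S
  | node l r => l.verts ∪ r.verts

/-- `T.HasLeaf S`: some leaf of `T` carries the set `S`. -/
def HasLeaf : ClusterTree n → Finset (Fin n) → Prop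
  | leaf S, X => X = S
  | node l r, X => l.HasLeaf X ∨ r.HasLeaf X

/-- Every internal node splits its vertex set into two disjoint nonempty parts (the vertex sets of
the nodes form a laminar family). -/
def Laminar : ClusterTree n → Prop
  | leaf S => S.Nonempty
  | node l r => Disjoint l.verts r.verts ∧ l.Laminar ∧ r.Laminar

/-- The lowest node of `T` that has all vertices of `X` below it, given as the subtree that is
rooted at it (meant for nonempty `X ⊆ T.verts`). In a laminar tree distinct nodes have distinct
subtrees, so that two nodes are equal iff the subtrees are. -/
def lca : ClusterTree n → Finset (Fin n) → ClusterTree n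
  | leaf S, _ => leaf S
  | node l r, X =>
      if X ⊆ l.verts then l.lca X
      else if X ⊆ r.verts then r.lca X
      else node l r

/-- A (standard) hierarchical clustering tree: the root is `V`, the leaves are the singletons. -/
def IsHCTree (T : ClusterTree n) : Prop :=
  T.Laminar ∧ T.verts = Finset.univ ∧ ∀ S, T.HasLeaf S → S.card = 1

/-- A partial hierarchical clustering tree: the root is `V`, and each leaf is a singleton or a
super-vertex, a set of at most `50000 log n` vertices. -/
def IsPartialHCTree (I : ClusterTree n) : Prop :=
  I.Laminar ∧ I.verts = Finset.univ ∧
    ∀ S, I.HasLeaf S → S.card = 1 ∨ (S.card : ℝ) ≤ 50000 * Real.log n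

/-- `X` induces a maximal subtree of `T`: the vertices below the LCA of `X` are exactly `X`. -/
def InducesMaximalSubtree (T : ClusterTree n) (X : Finset (Fin n)) : Prop :=
  (T.lca X).verts = X

/-- The partial tree `I` is strongly consistent with the hierarchical clustering tree `T`: each
leaf (each super-vertex) induces a maximal subtree of `T`, and for any two leaves `X`, `Y` of `I`
the LCA of the two leaves in `I` has the same vertices below it as the LCA of `X ∪ Y` in `T`. -/
def StronglyConsistent (I T : ClusterTree n) : Prop :=
  (∀ X, I.HasLeaf X → T.InducesMaximalSubtree X) ∧
  (∀ X Y, I.HasLeaf X → I.HasLeaf Y → (I.lca (X ∪ Y)).verts = (T.lca (X ∪ Y)).verts)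

/-- `w` splits away from `(u, v)` in `T`. -/
def SplitsAway (T : ClusterTree n) (w u v : Fin n) : Prop :=
  T.lca {w, u} = T.lca {u, v, w} ∧ T.lca {w, v} = T.lca {u, v, w}

end ClusterTree

/-! ## The splitting oracle -/

/-- A realization of the oracle: one fixed answer for each (unordered) triplet of vertices. The
values on sets that do not have three elements are meaningless. -/
abbrev Oracle (n : ℕ) : Type := Finset (Fin n) → Fin n

/-- `O` is a random splitting oracle for `T` with success probability `p`. There are events `E τ`
("the oracle is correct on the triplet `τ`"), independent over the triplets and each of probability
`p`. On `E τ` the answer to `τ` is the vertex that splits away from the two others in `T`. Outside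
`E τ` it is an arbitrary vertex of the triplet, chosen by an adversary who may look at the whole
outcome `ω`. -/
def IsSplittingOracle {n : ℕ} {Ω : Type*} [MeasurableSpace Ω] (P : Measure Ω)
    (O : Ω → Oracle n) (T : ClusterTree n) (p : ℝ≥0∞) : Prop :=
  (∀ τ x, MeasurableSet {ω | O ω τ = x}) ∧
  (∀ ω τ, τ.card = 3 → O ω τ ∈ τ) ∧
  ∃ E : {τ : Finset (Fin n) // τ.card = 3} → Set Ω,
    (∀ τ, MeasurableSet (E τ)) ∧
    iIndepSet E P ∧
    (∀ τ, P (E τ) = p) ∧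
    (∀ τ, ∀ ω ∈ E τ, ∀ u v w : Fin n, τ.1 = {u, v, w} → O ω τ.1 = w → T.SplitsAway w u v)

/-! ## Randomized word RAM programs with oracle access -/

/-- Arithmetic operations on words. -/
inductive Arith : Type
  | add | sub | mul | div

/-- The value of an operation, before truncation to the word size (subtraction is truncated at
zero, division is integer division, with `a / 0 = 0`). -/
def Arith.eval : Arith → ℕ → ℕ → ℕ
  | add, a, b => a + b
  | sub, a, b => a - b
  | mul, a, b => a * b
  | div, a, b => a / b

/-- Programs. The numbers `a`, `b`, `c`, `d` are memory addresses, and `M[a]` is the word stored at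
address `a`. -/
inductive Cmd : Type
  /-- do nothing -/
  | skip : Cmd
  /-- `M[d] := k` -/
  | const (d k : ℕ) : Cmd
  /-- `M[d] := M[a] o M[b]` -/
  | arith (o : Arith) (d a b : ℕ) : Cmd
  /-- `M[d] := M[M[a]]` -/
  | load (d a : ℕ) : Cmd
  /-- `M[M[a]] := M[b]` -/
  | store (a b : ℕ) : Cmd
  /-- `M[d] :=` a uniformly random element of `{0, …, M[a] - 1}` (and `0` if `M[a] = 0`) -/
  | rand (d a : ℕ) : Cmd
  /-- `M[d] :=` the answer of the oracle to the triplet `M[a], M[b], M[c]` -/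
  | query (d a b c : ℕ) : Cmd
  /-- sequential composition -/
  | seq (p q : Cmd) : Cmd
  /-- `if M[a] < M[b] then p else q` -/
  | ite (a b : ℕ) (p q : Cmd) : Cmd
  /-- `while M[a] < M[b] do p` -/
  | loop (a b : ℕ) (p : Cmd) : Cmd

/-- A configuration of the machine. -/
structure Config : Type where
  /-- The commands that remain to be executed, a control stack over subprograms of the program,
  whose height is bounded by the nesting depth of the program. -/
  todo : List Cmd
  /-- The memory. -/
  mem : ℕ → ℕ
  /-- The number of oracle queries so far, repeated queries included. -/
  queries : ℕ
  /-- The number of memory words in use: all addresses that were accessed so far are smaller. -/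
  space : ℕ

namespace Config

/-- Continue with `K` after an access to the addresses in `as`. -/
def goto (s : Config) (K : List Cmd) (as : List ℕ) : Config :=
  { s with todo := K, space := as.foldr (fun a m => max (a + 1) m) s.space }

/-- Continue with `K` after an access to the addresses in `as`, with `M[d] := x`. -/
def write (s : Config) (K : List Cmd) (as : List ℕ) (d x : ℕ) : Config :=
  { s.goto K (d :: as) with mem := Function.update s.mem d x }

/-- The machine has halted. -/
def Halted (s : Config) : Prop := s.todo = []

/-- Initially the word at address `0` is `n` and all other words are `0`. -/
def init (prog : Cmd) (n : ℕ) : Config where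
  todo := [prog]
  mem := Function.update (fun _ => 0) 0 n
  queries := 0
  space := 1

end Config

/-- The uniform distribution on `{0, …, m - 1}`, and the point mass at `0` if `m = 0`. -/
noncomputable def uniformBelow (m : ℕ) : PMF ℕ :=
  if h : 0 < m then
    PMF.uniformOfFinset (Finset.range m) (Finset.nonempty_range_iff.mpr h.ne')
  else PMF.pure 0

/-- The answer of the oracle to a query, as a word (`0` if some argument is not a vertex). -/
def Oracle.answer {n : ℕ} (O : Oracle n) (x y z : ℕ) : ℕ :=
  if h : x < n ∧ y < n ∧ z < n then
    (O {⟨x, h.1⟩, ⟨y, h.2.1⟩, ⟨z, h.2.2⟩} : ℕ)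
  else 0

/-- One step of the machine with words of `w` bits; it takes one unit of time. -/
noncomputable def step {n : ℕ} (w : ℕ) (O : Oracle n) (s : Config) : PMF Config :=
  match s.todo with
  | [] => PMF.pure s
  | .skip :: K => PMF.pure (s.goto K [])
  | .const d k :: K => PMF.pure (s.write K [] d (k % 2 ^ w))
  | .arith o d a b :: K =>
      PMF.pure (s.write K [a, b] d (o.eval (s.mem a) (s.mem b) % 2 ^ w))
  | .load d a :: K => PMF.pure (s.write K [a, s.mem a] d (s.mem (s.mem a)))
  | .store a b :: K => PMF.pure (s.write K [a, b] (s.mem a) (s.mem b))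
  | .rand d a :: K => (uniformBelow (s.mem a)).map fun x => s.write K [a] d x
  | .query d a b c :: K =>
      PMF.pure
        { s.write K [a, b, c] d (O.answer (s.mem a) (s.mem b) (s.mem c)) with
          queries := s.queries + 1 }
  | .seq p q :: K => PMF.pure (s.goto (p :: q :: K) [])
  | .ite a b p q :: K =>
      PMF.pure (if s.mem a < s.mem b then s.goto (p :: K) [a, b] else s.goto (q :: K) [a, b])
  | .loop a b p :: K =>
      PMF.pure (if s.mem a < s.mem b then s.goto (p :: .loop a b p :: K) [a, b]
        else s.goto K [a, b])

/-- The distribution, over the internal coins of the machine, of the configuration after `t` steps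
from the configuration `s` (a machine that has halted stays where it is). -/
noncomputable def runFrom {n : ℕ} (w : ℕ) (O : Oracle n) : ℕ → Config → PMF Config
  | 0, s => PMF.pure s
  | t + 1, s => (step w O s).bind (runFrom w O t)

/-- The number of bits of a word, `κ (⌊log₂ n⌋ + 1)`, for a constant `κ ≥ 1`; then `n`, the names of
the vertices and all other values that the machine ever computes fit into one word. -/
def wordSize (κ n : ℕ) : ℕ := κ * (Nat.log 2 n + 1)

/-- The distribution of the configuration after `t` steps of `prog` on input `n` with oracle `O`,
for the word size `wordSize κ n`. -/
noncomputable def run {n : ℕ} (prog : Cmd) (κ : ℕ) (O : Oracle n) (t : ℕ) : PMF Config :=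
  runFrom (wordSize κ n) O t (Config.init prog n)

/-- `Stores mem m a I`: the first `m` words of the memory hold the tree `I` with its root at address
`a`. An internal node is a record `0`, address of the left child, address of the right child; a
leaf is a record `k > 0`, address of an array that lists the `k` vertices of the leaf. -/
inductive Stores {n : ℕ} (mem : ℕ → ℕ) (m : ℕ) : ℕ → ClusterTree n → Prop
  | leaf (a : ℕ) (L : List (Fin n)) (hL : L ≠ []) (hnodup : L.Nodup)
      (ha : a + 1 < m) (hk : mem a = L.length) (hm : mem (a + 1) + L.length ≤ m)
      (hv : ∀ i (hi : i < L.length), mem (mem (a + 1) + i) = (L[i] : ℕ)) :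
      Stores mem m a (ClusterTree.leaf L.toFinset)
  | node (a : ℕ) (l r : ClusterTree n) (ha : a + 2 < m) (h0 : mem a = 0)
      (hl : Stores mem m (mem (a + 1)) l) (hr : Stores mem m (mem (a + 2)) r) :
      Stores mem m a (ClusterTree.node l r)

/-- The tree that the machine outputs: it is in the memory, and the word at address `0` points to
its root. -/
def Config.Outputs {n : ℕ} (s : Config) (I : ClusterTree n) : Prop :=
  s.Halted ∧ Stores s.mem s.space (s.mem 0) I

end HC

open HC

/-!
A tree obtained from the hidden tree by cutting off some subtrees, each of which becomes a leaf
with the set it carried, is strongly consistent with the hidden tree (`Prefix.stronglyConsistent`).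
Hence it suffices to split clusters, from the root on, exactly as the hidden tree does, as long as
they have more than `threshold n` vertices, a number of the order of `log n`.

Let `s` be such a cluster, with sides `a` and `b`, and let `u` and `v` be two of its vertices. The
answers to the triplets `{u, v, w}`, where `w` runs through `s`, are a vote. If `u` is in `a` and
`v` is in `b`, then correct answers are `v` for `w` in `a` and `u` for `w` in `b`, so the number of
votes for `v` estimates the size of `a`. If `u` and `v` are both in `a`, then the correct answer is
`w` for all `w` in `b`, whereas for `u` and `v` on different sides no correct answer is `w`. The
errors of a vote come from distinct triplets, so they are independent, and a Chernoff bound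
(`measure_many_fail_le`) shows that all but an eighth of the answers are correct, outside an event
of probability `n⁻⁵`, say. There are at most `n ^ 2` clusters, as each is the lowest common
ancestor of a pair, and at most `n ^ 2` pairs `u, v`, so with probability `1 - 1 / n` every vote in
every large cluster is good (`Reliable`, `IsSplittingOracle.exists_reliable`). The bound is over
the clusters of the hidden tree, which do not depend on the oracle, and only the correctness of the
answers is used, so the order in which the program asks and the choices of the adversary do not
matter.

A good vote splits the cluster in two scans (`Reliable.split`). In the first one a champion `u`
meets the other vertices in turn and is replaced by `v` when more than half of the votes are for
`v`, which, for `u` and `v` on different sides that are not nearly balanced, means that `v` is on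
the smaller side. If one side has less than a third of the vertices, then the final champion
belongs to it; in any case at least a third of the cluster is not on the side of the champion. In
the second scan `v` is put on the side of `u` if more than a sixth of the answers are the third
vertex: at least `1/3 - 1/8` of them are if `v` is on that side, and not much more than `1/8`
otherwise.

Both scans permute the vertices of the cluster in place, so a cluster is a segment of one array,
and the leaves of the partial tree, stored as records in order of creation, are the queue of
clusters to be treated. There are fewer than `2 * n` records of three words, so that `8 * n + 33`
words suffice, and each costs at most two scans with a quadratic number of steps and queries. The
program tosses no coins, so that its run is a Dirac measure (`exists_run_eq_pure`); its correctness
is proved in a small program logic (`Reaches`, `pre`).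
-/

namespace HC

/-! ### Subtrees, lowest common ancestors and prefixes of a tree -/

namespace ClusterTree

variable {n : ℕ}

/-- `s.Sub T`: the tree `s` is the subtree of `T` that is rooted at some node of `T`. -/
def Sub (s : ClusterTree n) : ClusterTree n → Prop
  | leaf S => s = leaf S
  | node l r => s = node l r ∨ s.Sub l ∨ s.Sub r

theorem Sub.refl (T : ClusterTree n) : T.Sub T := by
  cases T <;> simp [Sub]

theorem Sub.trans {s t T : ClusterTree n} (h : s.Sub t) (h' : t.Sub T) : s.Sub T := by
  induction T with
  | leaf S => simp only [Sub] at h'; subst h'; exact h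
  | node l r ihl ihr =>
    rcases h' with rfl | h' | h'
    · exact h
    · exact Or.inr (Or.inl (ihl h'))
    · exact Or.inr (Or.inr (ihr h'))

theorem sub_left (l r : ClusterTree n) : l.Sub (node l r) := Or.inr (Or.inl (Sub.refl l))

theorem sub_right (l r : ClusterTree n) : r.Sub (node l r) := Or.inr (Or.inr (Sub.refl r))

theorem Sub.laminar {s T : ClusterTree n} (h : s.Sub T) (hT : T.Laminar) : s.Laminar := by
  induction T with
  | leaf S => simp only [Sub] at h; subst h; exact hT
  | node l r ihl ihr =>
    rcases h with rfl | h | h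
    · exact hT
    · exact ihl h hT.2.1
    · exact ihr h hT.2.2

theorem Sub.verts_subset {s T : ClusterTree n} (h : s.Sub T) : s.verts ⊆ T.verts := by
  induction T with
  | leaf S => simp only [Sub] at h; subst h; exact subset_rfl
  | node l r ihl ihr =>
    rcases h with rfl | h | h
    · exact subset_rfl
    · exact (ihl h).trans Finset.subset_union_left
    · exact (ihr h).trans Finset.subset_union_right

theorem Laminar.verts_nonempty {T : ClusterTree n} (h : T.Laminar) : T.verts.Nonempty := by
  induction T with
  | leaf S => exact h
  | node l r ihl _ => exact (ihl h.2.1).mono Finset.subset_union_left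

theorem HasLeaf.sub {T : ClusterTree n} {X : Finset (Fin n)} (h : T.HasLeaf X) :
    (leaf X).Sub T := by
  induction T with
  | leaf S => simp only [HasLeaf] at h; subst h; rfl
  | node l r ihl ihr => exact Or.inr (h.imp ihl ihr)

theorem HasLeaf.of_sub {s T : ClusterTree n} {X : Finset (Fin n)} (h : s.HasLeaf X)
    (hs : s.Sub T) : T.HasLeaf X := by
  induction T with
  | leaf S => simp only [Sub] at hs; subst hs; exact h
  | node l r ihl ihr =>
    rcases hs with rfl | hs | hs
    · exact h
    · exact Or.inl (ihl hs)
    · exact Or.inr (ihr hs)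

theorem HasLeaf.subset {T : ClusterTree n} {X : Finset (Fin n)} (h : T.HasLeaf X) :
    X ⊆ T.verts :=
  h.sub.verts_subset

theorem HasLeaf.nonempty {T : ClusterTree n} {X : Finset (Fin n)} (h : T.HasLeaf X)
    (hT : T.Laminar) : X.Nonempty :=
  h.sub.laminar hT

theorem lca_node_left {l r : ClusterTree n} {X : Finset (Fin n)} (h : X ⊆ l.verts) :
    (node l r).lca X = l.lca X := by
  simp [lca, h]

theorem lca_node_right {l r : ClusterTree n} {X : Finset (Fin n)} (hX : X.Nonempty)
    (hd : Disjoint l.verts r.verts) (h : X ⊆ r.verts) : (node l r).lca X = r.lca X := by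
  have : ¬ X ⊆ l.verts := fun h' => by
    obtain ⟨x, hx⟩ := hX
    exact Finset.disjoint_left.1 hd (h' hx) (h hx)
  simp [lca, h, this]

theorem lca_node_eq_self {l r : ClusterTree n} {X : Finset (Fin n)} {x y : Fin n}
    (hd : Disjoint l.verts r.verts) (hx : x ∈ X) (hy : y ∈ X) (hxl : x ∈ l.verts)
    (hyr : y ∈ r.verts) : (node l r).lca X = node l r := by
  have h1 : ¬ X ⊆ l.verts := fun h => Finset.disjoint_left.1 hd (h hy) hyr
  have h2 : ¬ X ⊆ r.verts := fun h => Finset.disjoint_left.1 hd hxl (h hx)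
  simp [lca, h1, h2]

/-- Lowest common ancestors are the same in a tree and in a subtree. -/
theorem Sub.lca_eq {s T : ClusterTree n} (h : s.Sub T) (hT : T.Laminar) {X : Finset (Fin n)}
    (hX : X.Nonempty) (hs : X ⊆ s.verts) : T.lca X = s.lca X := by
  induction T with
  | leaf S => simp only [Sub] at h; subst h; rfl
  | node l r ihl ihr =>
    rcases h with rfl | h | h
    · rfl
    · rw [lca_node_left (hs.trans h.verts_subset), ihl h hT.2.1]
    · rw [lca_node_right hX hT.1 (hs.trans h.verts_subset), ihr h hT.2.2]

theorem Laminar.lca_verts {s : ClusterTree n} (h : s.Laminar) : s.lca s.verts = s := by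
  cases s with
  | leaf S => rfl
  | node l r =>
    obtain ⟨x, hx⟩ := h.2.1.verts_nonempty
    obtain ⟨y, hy⟩ := h.2.2.verts_nonempty
    exact lca_node_eq_self h.1 (Finset.mem_union_left _ hx) (Finset.mem_union_right _ hy) hx hy

theorem Sub.lca_verts {s T : ClusterTree n} (h : s.Sub T) (hT : T.Laminar) :
    T.lca s.verts = s :=
  (h.lca_eq hT (h.laminar hT).verts_nonempty subset_rfl).trans (h.laminar hT).lca_verts

theorem lca_verts_subset (T : ClusterTree n) (X : Finset (Fin n)) :
    (T.lca X).verts ⊆ T.verts := by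
  induction T with
  | leaf S => exact subset_rfl
  | node l r ihl ihr =>
    simp only [lca]
    split_ifs
    · exact ihl.trans Finset.subset_union_left
    · exact ihr.trans Finset.subset_union_right
    · exact subset_rfl

/-- `Children s a b`: the two children of the root of `s`, in some order, are `a` and `b`. -/
inductive Children : ClusterTree n → ClusterTree n → ClusterTree n → Prop
  | left (l r : ClusterTree n) : Children (node l r) l r
  | right (l r : ClusterTree n) : Children (node l r) r l

theorem Children.symm {s a b : ClusterTree n} (h : Children s a b) : Children s b a := by
  cases h
  · exact .right _ _
  · exact .left _ _

theorem Children.sub_fst {s a b : ClusterTree n} (h : Children s a b) : a.Sub s := by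
  cases h
  · exact sub_left _ _
  · exact sub_right _ _

theorem Children.disjoint {s a b : ClusterTree n} (h : Children s a b) (hs : s.Laminar) :
    Disjoint a.verts b.verts := by
  cases h
  · exact hs.1
  · exact hs.1.symm

theorem Children.verts_eq {s a b : ClusterTree n} (h : Children s a b) :
    s.verts = a.verts ∪ b.verts := by
  cases h
  · rfl
  · exact Finset.union_comm _ _

theorem Children.lca_of_subset {s a b : ClusterTree n} (h : Children s a b) (hs : s.Laminar)
    {X : Finset (Fin n)} (hX : X.Nonempty) (ha : X ⊆ a.verts) : s.lca X = a.lca X :=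
  h.sub_fst.lca_eq hs hX ha

theorem Children.lca_eq_self {s a b : ClusterTree n} (h : Children s a b) (hs : s.Laminar)
    {X : Finset (Fin n)} {x y : Fin n} (hx : x ∈ X) (hy : y ∈ X) (hxa : x ∈ a.verts)
    (hyb : y ∈ b.verts) : s.lca X = s := by
  cases h
  · exact lca_node_eq_self hs.1 hx hy hxa hyb
  · exact lca_node_eq_self hs.1 hy hx hyb hxa

/-- Every internal node is the lowest common ancestor of a pair of vertices. -/
theorem Sub.exists_lca_pair {l r T : ClusterTree n} (h : (node l r).Sub T) (hT : T.Laminar) :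
    ∃ x y, T.lca {x, y} = node l r := by
  have hs := h.laminar hT
  obtain ⟨x, hx⟩ := hs.2.1.verts_nonempty
  obtain ⟨y, hy⟩ := hs.2.2.verts_nonempty
  refine ⟨x, y, ?_⟩
  rw [h.lca_eq hT ⟨x, by simp⟩, lca_node_eq_self hs.1 (x := x) (y := y) (by simp) (by simp) hx hy]
  intro z hz
  simp only [Finset.mem_insert, Finset.mem_singleton] at hz
  rcases hz with rfl | rfl
  · exact Finset.mem_union_left _ hx
  · exact Finset.mem_union_right _ hy

/-- If the root of the subtree `s` separates `u`, `v` from `w`, then neither `u` nor `v` splits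
away from the two other vertices. -/
theorem Children.not_splitsAway {s a b T : ClusterTree n} (h : Children s a b) (hsT : s.Sub T)
    (hT : T.Laminar) {u v w : Fin n} (hu : u ∈ a.verts) (hv : v ∈ a.verts) (hw : w ∈ b.verts) :
    ¬ T.SplitsAway u v w := by
  rintro ⟨h1, -⟩
  have hs := hsT.laminar hT
  have hX : ({u, v} : Finset (Fin n)) ⊆ a.verts := by
    intro z hz
    simp only [Finset.mem_insert, Finset.mem_singleton] at hz
    rcases hz with rfl | rfl <;> assumption
  have hY : ({v, w, u} : Finset (Fin n)) ⊆ s.verts := by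
    intro z hz
    rw [h.verts_eq]
    simp only [Finset.mem_insert, Finset.mem_singleton] at hz
    rcases hz with rfl | rfl | rfl
    · exact Finset.mem_union_left _ hv
    · exact Finset.mem_union_right _ hw
    · exact Finset.mem_union_left _ hu
  rw [hsT.lca_eq hT ⟨u, by simp⟩ hY, h.lca_eq_self hs (x := u) (y := w) (by simp) (by simp) hu hw,
    (h.sub_fst.trans hsT).lca_eq hT ⟨u, by simp⟩ hX] at h1
  have := lca_verts_subset a {u, v}
  rw [h1, h.verts_eq] at this
  exact Finset.disjoint_left.1 (h.disjoint hs) (this (Finset.mem_union_right _ hw)) hw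

/-- `Prefix I t`: the partial tree `I` is obtained from `t` by contracting some subtrees to
super-vertices (and by exchanging left and right children). -/
inductive Prefix : ClusterTree n → ClusterTree n → Prop
  | leaf (t : ClusterTree n) : Prefix (leaf t.verts) t
  | node {s a b I J : ClusterTree n} (h : Children s a b) (hI : Prefix I a) (hJ : Prefix J b) :
      Prefix (node I J) s

theorem Prefix.verts_eq {I t : ClusterTree n} (h : Prefix I t) : I.verts = t.verts := by
  induction h with
  | leaf t => rfl
  | node h _ _ ihI ihJ => rw [h.verts_eq, verts, ihI, ihJ]

theorem Prefix.laminar {I t : ClusterTree n} (h : Prefix I t) (ht : t.Laminar) : I.Laminar := by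
  induction h with
  | leaf t => exact ht.verts_nonempty
  | node h hI hJ ihI ihJ =>
    refine ⟨?_, ihI (h.sub_fst.laminar ht), ihJ (h.symm.sub_fst.laminar ht)⟩
    rw [hI.verts_eq, hJ.verts_eq]
    exact h.disjoint ht

theorem Prefix.exists_sub {I t : ClusterTree n} (h : Prefix I t) {X : Finset (Fin n)}
    (hX : I.HasLeaf X) : ∃ s : ClusterTree n, s.Sub t ∧ s.verts = X := by
  induction h with
  | leaf t => exact ⟨t, Sub.refl t, hX.symm⟩
  | node h _ _ ihI ihJ =>
    rcases hX with hX | hX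
    · obtain ⟨s, hs, hsX⟩ := ihI hX
      exact ⟨s, hs.trans h.sub_fst, hsX⟩
    · obtain ⟨s, hs, hsX⟩ := ihJ hX
      exact ⟨s, hs.trans h.symm.sub_fst, hsX⟩

theorem Prefix.lca_leaves {I t : ClusterTree n} (h : Prefix I t) (ht : t.Laminar)
    {X Y : Finset (Fin n)} (hX : I.HasLeaf X) (hY : I.HasLeaf Y) :
    (I.lca (X ∪ Y)).verts = (t.lca (X ∪ Y)).verts := by
  induction h with
  | leaf t =>
    simp only [HasLeaf] at hX hY
    subst hX hY
    rw [Finset.union_self, ht.lca_verts]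
    rfl
  | @node s a b I J h hI hJ ihI ihJ =>
    have hl := (Prefix.node h hI hJ).laminar ht
    have ha := h.sub_fst.laminar ht
    have hb := h.symm.sub_fst.laminar ht
    have hXY : (X ∪ Y).Nonempty := (HasLeaf.nonempty hX hl).mono Finset.subset_union_left
    have key : ∀ {Z W I' J' : _} {a' b' : ClusterTree n}, Children s a' b' → I'.Laminar →
        J'.Laminar → Prefix I' a' → Prefix J' b' → I'.HasLeaf Z → J'.HasLeaf W →
        s.lca (Z ∪ W) = s := by
      intro Z W I' J' a' b' hc hI' hJ' hpI hpJ hZ hW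
      obtain ⟨z, hz⟩ : Z.Nonempty := hZ.nonempty hI'
      obtain ⟨w, hw⟩ : W.Nonempty := hW.nonempty hJ'
      refine hc.lca_eq_self ht (Finset.mem_union_left _ hz) (Finset.mem_union_right _ hw) ?_ ?_
      · rw [← hpI.verts_eq]; exact hZ.subset hz
      · rw [← hpJ.verts_eq]; exact hW.subset hw
    have hroot : ∀ {Z W}, I.HasLeaf Z → J.HasLeaf W →
        (ClusterTree.node I J).lca (Z ∪ W) = ClusterTree.node I J := by
      intro Z W hZ hW
      obtain ⟨z, hz⟩ : Z.Nonempty := hZ.nonempty hl.2.1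
      obtain ⟨w, hw⟩ : W.Nonempty := hW.nonempty hl.2.2
      exact lca_node_eq_self hl.1 (Finset.mem_union_left _ hz) (Finset.mem_union_right _ hw)
        (hZ.subset hz) (hW.subset hw)
    have hv := (Prefix.node h hI hJ).verts_eq
    rcases hX with hX | hX <;> rcases hY with hY | hY
    · have hs := Finset.union_subset hX.subset hY.subset
      rw [lca_node_left hs, h.lca_of_subset ht hXY (hI.verts_eq ▸ hs)]
      exact ihI ha hX hY
    · rw [hroot hX hY, key h hl.2.1 hl.2.2 hI hJ hX hY, hv]
    · rw [Finset.union_comm, hroot hY hX, key h hl.2.1 hl.2.2 hI hJ hY hX, hv]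
    · have hs := Finset.union_subset hX.subset hY.subset
      rw [lca_node_right hXY hl.1 hs, h.symm.lca_of_subset ht hXY (hJ.verts_eq ▸ hs)]
      exact ihJ hb hX hY

theorem Prefix.stronglyConsistent {I T : ClusterTree n} (h : Prefix I T) (hT : T.Laminar) :
    I.StronglyConsistent T := by
  refine ⟨fun X hX => ?_, fun X Y hX hY => h.lca_leaves hT hX hY⟩
  obtain ⟨s, hs, rfl⟩ := h.exists_sub hX
  rw [InducesMaximalSubtree, hs.lca_verts hT]

end ClusterTree

/-! ### Concentration of the number of wrong answers -/

/-- A Chernoff bound: among at most `N` independent events of probability `9/10`, more than `N/8`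
fail with exponentially small probability. The exponential moment is taken at the base
`1.03 ^ 8`. -/
theorem measure_many_fail_le {ι Ω : Type*} [Fintype ι] [MeasurableSpace Ω] {P : Measure Ω}
    [IsProbabilityMeasure P] {E : ι → Set Ω} (hE : ∀ i, MeasurableSet (E i))
    (hind : iIndepSet E P) (hp : ∀ i, P (E i) = 9 / 10) {N : ℕ} (hN : Fintype.card ι ≤ N)
    [∀ ω, DecidablePred fun i => ω ∉ E i] :
    P {ω | N < 8 * (Finset.univ.filter fun i => ω ∉ E i).card} ≤
      ENNReal.ofReal ((9968 / 10000) ^ N) := by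
  set X : ι → Ω → ℝ := fun i => (E i).indicator fun _ => 1 with hX
  have hXind : iIndepFun X P := hind.iIndepFun_indicator
  have hXm : ∀ i, Measurable (X i) := fun i => measurable_const.indicator (hE i)
  set c : ℝ := (103 / 100) ^ 8 with hc
  have hc1 : 1 ≤ c := by rw [hc]; norm_num
  have hYm : ∀ i, Measurable (fun ω => c - (c - 1) * X i ω) := fun i =>
    measurable_const.sub ((hXm i).const_mul _)
  have hval : ∀ i ω, c - (c - 1) * X i ω = if ω ∉ E i then c else 1 := by
    intro i ω
    by_cases h : ω ∈ E i <;> simp [hX, h]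
  have hreal : ∀ i, P.real (E i) = 9 / 10 := by
    intro i
    rw [measureReal_def, hp i, ENNReal.toReal_div]
    norm_num
  have hXint : ∀ i, Integrable (X i) P := fun i => (integrable_const 1).indicator (hE i)
  have hint1 : ∀ i, ∫ ω, (c - (c - 1) * X i ω) ∂P = c - (c - 1) * (9 / 10) := by
    intro i
    rw [integral_sub (integrable_const _) ((hXint i).const_mul _), integral_const_mul]
    simp only [hX]
    rw [integral_indicator_const _ (hE i), hreal i]
    simp
  have hprod : ∫ ω, ∏ i, (c - (c - 1) * X i ω) ∂P = (c - (c - 1) * (9 / 10)) ^ Fintype.card ι := by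
    rw [iIndepFun.integral_fun_prod_eq_prod_integral (X := fun i ω => c - (c - 1) * X i ω)
      (hXind.comp (fun _ x => c - (c - 1) * x) fun _ => by fun_prop)
      (fun i => (hYm i).aestronglyMeasurable)]
    simp [hint1]
  have hpow : ∀ ω, ∏ i, (c - (c - 1) * X i ω) =
      c ^ (Finset.univ.filter fun i => ω ∉ E i).card := by
    intro ω
    simp only [hval]
    rw [Finset.prod_ite]
    simp
  have hnn : ∀ ω, 0 ≤ ∏ i, (c - (c - 1) * X i ω) := fun ω => by rw [hpow]; positivity
  have hbdd : ∀ ω, ∏ i, (c - (c - 1) * X i ω) ≤ c ^ Fintype.card ι := fun ω => by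
    rw [hpow]
    exact pow_le_pow_right₀ hc1 (Finset.card_le_univ _)
  have hYint : Integrable (fun ω => ∏ i, (c - (c - 1) * X i ω)) P := by
    refine Integrable.of_bound (Finset.measurable_prod _ fun i _ => hYm i).aestronglyMeasurable
      (c ^ Fintype.card ι) (ae_of_all _ fun ω => ?_)
    rw [Real.norm_of_nonneg (hnn ω)]
    exact hbdd ω
  have hmarkov := mul_meas_ge_le_integral_of_nonneg (ae_of_all _ hnn) hYint ((103 / 100 : ℝ) ^ N)
  rw [hprod] at hmarkov
  have hle : (c - (c - 1) * (9 / 10)) ^ Fintype.card ι ≤ (c - (c - 1) * (9 / 10)) ^ N :=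
    pow_le_pow_right₀ (by linarith) hN
  have hbase : (c - (c - 1) * (9 / 10)) ≤ 103 / 100 * (9968 / 10000) := by rw [hc]; norm_num
  have hle2 : (c - (c - 1) * (9 / 10)) ^ N ≤ (103 / 100) ^ N * (9968 / 10000) ^ N := by
    rw [← mul_pow]
    exact pow_le_pow_left₀ (by linarith) hbase N
  have hfin := le_of_mul_le_mul_left ((hmarkov.trans hle).trans hle2) (by positivity)
  refine (measure_mono fun ω hω => ?_).trans
    ((ENNReal.le_ofReal_iff_toReal_le (measure_ne_top _ _) (by positivity)).2 hfin)
  simp only [Set.mem_ofPred_eq] at hω ⊢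
  rw [hpow, hc, ← pow_mul]
  exact pow_le_pow_right₀ (by norm_num) hω.le

/-- The triplets `{u, v, w}` of distinct vertices are determined by `w`. -/
theorem insert_pair_injOn {α : Type*} [DecidableEq α] {u v w w' : α} (hu : w ≠ u)
    (hv : w ≠ v) (h : ({u, v, w} : Finset α) = {u, v, w'}) : w = w' := by
  have : w ∈ ({u, v, w'} : Finset α) := h ▸ by simp
  simpa [hu, hv] using this

/-- The size up to which clusters are not split. -/
def threshold (n : ℕ) : ℕ := 30000 * Nat.log 2 n

theorem threshold_le {n : ℕ} (hn : 2 ≤ n) : (threshold n : ℝ) ≤ 50000 * Real.log n := by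
  have h1 : (2 : ℝ) ^ Nat.log 2 n ≤ n := by exact_mod_cast Nat.pow_log_le_self 2 (by omega)
  have h2 := Real.log_le_log (by positivity) h1
  rw [Real.log_pow] at h2
  have h3 := Real.log_two_gt_d9
  have h4 : (0 : ℝ) ≤ (Nat.log 2 n : ℝ) := by positivity
  rw [threshold]
  push_cast
  nlinarith

/-- The answers of an oracle are reliable for `T` up to the set `bad` of triplets, and each pair of
vertices is, within each large cluster, in few bad triplets. -/
structure Reliable {n : ℕ} (O : Oracle n) (T : ClusterTree n) (bad : Finset (Fin n) → Prop) :
    Prop where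
  mem : ∀ τ, τ.card = 3 → O τ ∈ τ
  splitsAway : ∀ τ, τ.card = 3 → ¬ bad τ → ∀ u v w, τ = {u, v, w} → O τ = w → T.SplitsAway w u v
  few : ∀ x y u v, threshold n < (T.lca {x, y}).verts.card →
    ∀ W ⊆ (T.lca {x, y}).verts, (∀ w ∈ W, w ≠ u ∧ w ≠ v ∧ bad {u, v, w}) →
      u ≠ v → 8 * W.card ≤ (T.lca {x, y}).verts.card

open Classical in
/-- For a pair `u, v` and a fixed set `S`, the errors of the answers to `{u, v, w}` with `w ∈ S` are
rarely more than an eighth of `S`. -/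
theorem measure_pair_fail_le {n : ℕ} {Ω : Type*} [MeasurableSpace Ω] {P : Measure Ω}
    [IsProbabilityMeasure P] {E : {τ : Finset (Fin n) // τ.card = 3} → Set Ω}
    (hE : ∀ i, MeasurableSet (E i)) (hind : iIndepSet E P) (hp : ∀ i, P (E i) = 9 / 10)
    (S : Finset (Fin n)) {u v : Fin n} (huv : u ≠ v) :
    P {ω | S.card < 8 * (S.filter fun w => w ≠ u ∧ w ≠ v ∧
        ∃ h : ({u, v, w} : Finset (Fin n)).card = 3, ω ∉ E ⟨{u, v, w}, h⟩).card} ≤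
      ENNReal.ofReal ((9968 / 10000) ^ S.card) := by
  let ι := {w // w ∈ S.filter fun w => w ≠ u ∧ w ≠ v}
  have h3 : ∀ w : ι, ({u, v, w.1} : Finset (Fin n)).card = 3 := by
    rintro ⟨w, hw⟩
    simp only [Finset.mem_filter] at hw
    exact Finset.card_eq_three.2 ⟨u, v, w, huv, hw.2.1.symm, hw.2.2.symm, rfl⟩
  let g : ι → {τ : Finset (Fin n) // τ.card = 3} := fun w => ⟨{u, v, w.1}, h3 w⟩
  have hg : Function.Injective g := by
    rintro ⟨w, hw⟩ ⟨w', hw'⟩ h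
    simp only [Finset.mem_filter] at hw
    exact Subtype.ext (insert_pair_injOn hw.2.1 hw.2.2 (Subtype.ext_iff.1 h))
  have hcard : Fintype.card ι ≤ S.card := by
    exact (Fintype.card_coe _).trans_le (Finset.card_filter_le _ _)
  refine (measure_mono fun ω hω => ?_).trans
    (measure_many_fail_le (fun i => hE (g i)) (hind.precomp hg) (fun i => hp (g i)) hcard)
  simp only [Set.mem_ofPred_eq] at hω ⊢
  refine hω.trans_le (Nat.mul_le_mul_left _ ?_)
  refine (Finset.card_le_card fun w hw => ?_).trans (Finset.card_image_le (f := Subtype.val))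
  simp only [Finset.mem_filter] at hw
  obtain ⟨hwS, hwu, hwv, h, hwE⟩ := hw
  refine Finset.mem_image.2 ⟨⟨w, Finset.mem_filter.2 ⟨hwS, hwu, hwv⟩⟩, ?_, rfl⟩
  exact Finset.mem_filter.2 ⟨Finset.mem_univ _, hwE⟩

/-- The failure probability of one vote, summed over all quadruples of vertices: two of them stand
for the pair that votes are about, the other two for the cluster of which they are the lowest common
ancestor. -/
theorem union_bound_le {n : ℕ} (hn : 2 ≤ n) {N : ℕ} (hN : threshold n < N) :
    (n : ℝ) ^ 4 * (9968 / 10000) ^ N ≤ 1 / n := by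
  set L := Nat.log 2 n with hL
  have hL1 : 1 ≤ L := Nat.log_pos (by norm_num) hn
  have h1 : ((9968 / 10000 : ℝ)) ^ N ≤ ((1 / 2) ^ 10) ^ L := by
    calc ((9968 / 10000 : ℝ)) ^ N ≤ (9968 / 10000) ^ (240 * 10 * L) :=
          pow_le_pow_of_le_one (by norm_num) (by norm_num) (by rw [threshold] at hN; lia)
      _ = (((9968 / 10000) ^ 240) ^ 10) ^ L := by rw [pow_mul, pow_mul]
      _ ≤ _ := by gcongr; norm_num
  have h2 : (n : ℝ) ≤ 2 ^ (2 * L) := by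
    have : n < 2 ^ (L + 1) := Nat.lt_pow_succ_log_self (by norm_num) n
    have h3 : 2 ^ (L + 1) ≤ 2 ^ (2 * L) := Nat.pow_le_pow_right (by norm_num) (by omega)
    exact_mod_cast (this.trans_le h3).le
  have hn0 : (0 : ℝ) < n := by positivity
  rw [le_div_iff₀ hn0]
  calc (n : ℝ) ^ 4 * (9968 / 10000) ^ N * n = n ^ 5 * (9968 / 10000) ^ N := by ring
    _ ≤ (2 ^ (2 * L)) ^ 5 * ((1 / 2) ^ 10) ^ L := by gcongr
    _ = 1 := by
      rw [← pow_mul, ← pow_mul, show 2 * L * 5 = 10 * L by ring, ← mul_pow]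
      norm_num

open Classical in
/-- With probability at least `1 - 1/n` the oracle is reliable. -/
theorem IsSplittingOracle.exists_reliable {n : ℕ} (hn : 2 ≤ n) {Ω : Type*} [MeasurableSpace Ω]
    {P : Measure Ω} [IsProbabilityMeasure P] {O : Ω → Oracle n} {T : ClusterTree n}
    (h : IsSplittingOracle P O T (9 / 10)) :
    ∃ G : Set Ω, MeasurableSet G ∧ 1 - 1 / (n : ℝ≥0∞) ≤ P G ∧
      ∀ ω ∈ G, ∃ bad, Reliable (O ω) T bad := by
  obtain ⟨-, hmem, E, hE, hind, hp, hsplit⟩ := h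
  let cl : Fin n × Fin n × Fin n × Fin n → Finset (Fin n) := fun z => (T.lca {z.1, z.2.1}).verts
  let F : Fin n × Fin n × Fin n × Fin n → Set Ω := fun z =>
    if threshold n < (cl z).card ∧ z.2.2.1 ≠ z.2.2.2 then
      {ω | (cl z).card < 8 * ((cl z).filter fun w => w ≠ z.2.2.1 ∧ w ≠ z.2.2.2 ∧
        ∃ h : ({z.2.2.1, z.2.2.2, w} : Finset (Fin n)).card = 3,
          ω ∉ E ⟨{z.2.2.1, z.2.2.2, w}, h⟩).card}
    else ∅
  have hF : ∀ z, P (F z) ≤ ENNReal.ofReal (1 / n / n ^ 4) := by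
    intro z
    simp only [F]
    split_ifs with hz
    · refine (measure_pair_fail_le hE hind hp (cl z) hz.2).trans (ENNReal.ofReal_le_ofReal ?_)
      rw [le_div_iff₀' (by positivity)]
      exact union_bound_le hn hz.1
    · simp
  set B : Set Ω := ⋃ z, F z with hB
  have hn0 : (0 : ℝ) < n := by positivity
  have hPB : P B ≤ 1 / (n : ℝ≥0∞) := by
    refine (measure_iUnion_le F).trans ?_
    rw [tsum_fintype]
    refine (Finset.sum_le_card_nsmul _ _ _ fun z _ => hF z).trans ?_
    rw [nsmul_eq_mul, Finset.card_univ, ← ENNReal.ofReal_natCast,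
      ← ENNReal.ofReal_mul (by positivity)]
    simp only [Fintype.card_prod, Fintype.card_fin]
    rw [← ENNReal.ofReal_natCast n, ← ENNReal.ofReal_one, ← ENNReal.ofReal_div_of_pos hn0]
    refine ENNReal.ofReal_le_ofReal (le_of_eq ?_)
    push_cast
    field_simp
  refine ⟨(toMeasurable P B)ᶜ, (measurableSet_toMeasurable _ _).compl, ?_, fun ω hω =>
    ⟨fun τ => ∃ h : τ.card = 3, ω ∉ E ⟨τ, h⟩, hmem ω, ?_, ?_⟩⟩
  · rw [prob_compl_eq_one_sub (measurableSet_toMeasurable _ _), measure_toMeasurable]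
    exact tsub_le_tsub_left hPB _
  · intro τ hτ hbad u v w huvw hO
    push Not at hbad
    exact hsplit ⟨τ, hτ⟩ ω (hbad hτ) u v w huvw hO
  · intro x y u v hlarge W hW hWbad huv
    have hωB : ω ∉ B := fun h => hω (subset_toMeasurable _ _ h)
    have hωF : ω ∉ F (x, y, u, v) := fun h => hωB (Set.mem_iUnion_of_mem _ h)
    simp only [F, cl, hlarge, huv, ne_eq, not_false_eq_true, and_self, if_true,
      Set.mem_ofPred_eq, not_lt] at hωF
    refine le_trans (Nat.mul_le_mul_left _ (Finset.card_le_card fun w hw => ?_)) hωF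
    exact Finset.mem_filter.2 ⟨hW hw, hWbad w hw⟩

/-! ### Counting votes inside a cluster -/

section Votes

open ClusterTree

variable {n : ℕ} {O : Oracle n} {T s a b : ClusterTree n} {bad : Finset (Fin n) → Prop}

/-- A good triplet that is cut by the root of `s` is answered by the vertex that is alone on its
side. -/
theorem Reliable.answer_eq (hR : Reliable O T bad) (hT : T.Laminar) (hs : s.Sub T)
    (hc : Children s a b) {x y z : Fin n} (hx : x ∈ a.verts) (hy : y ∈ a.verts) (hz : z ∈ b.verts)
    (hxy : x ≠ y) {τ : Finset (Fin n)} (hτ : τ = {x, y, z}) (hbad : ¬ bad τ) : O τ = z := by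
  have hd := Finset.disjoint_left.1 (hc.disjoint (hs.laminar hT))
  have hxz : x ≠ z := by rintro rfl; exact hd hx hz
  have hyz : y ≠ z := by rintro rfl; exact hd hy hz
  have h3 : τ.card = 3 := Finset.card_eq_three.2 ⟨x, y, z, hxy, hxz, hyz, hτ⟩
  have hmem := hR.mem τ h3
  have hsp := hR.splitsAway τ h3 hbad
  rw [hτ] at hmem
  simp only [Finset.mem_insert, Finset.mem_singleton] at hmem
  rw [← hτ] at hmem
  rcases hmem with h | h | h
  · exact absurd (hsp y z x (by rw [hτ]; ext; simp; tauto) h)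
      (hc.not_splitsAway hs hT hx hy hz)
  · exact absurd (hsp x z y (by rw [hτ]; ext; simp; tauto) h)
      (hc.not_splitsAway hs hT hy hx hz)
  · exact h

/-- `votes O own S u v` is the number of `w ∈ S` for which the answer to `{u, v, w}` is `w` (if
`own` is true) or `v` (if `own` is false). -/
def votes (O : Oracle n) (own : Bool) (S : Finset (Fin n)) (u v : Fin n) : ℕ :=
  (S.filter fun w => O {u, v, w} = if own then w else v).card

theorem threshold_pos (hn : 2 ≤ n) : 30000 ≤ threshold n := by
  have : 0 < Nat.log 2 n := Nat.log_pos (by norm_num) hn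
  rw [threshold]
  omega

open Classical in
/-- The vertices of the subtree `s` whose triplet with `u` and `v` is bad. -/
noncomputable def badVerts (bad : Finset (Fin n) → Prop) (s : ClusterTree n) (u v : Fin n) :
    Finset (Fin n) :=
  s.verts.filter fun w => w ≠ u ∧ w ≠ v ∧ bad {u, v, w}

theorem mem_badVerts {u v w : Fin n} :
    w ∈ badVerts bad s u v ↔ w ∈ s.verts ∧ w ≠ u ∧ w ≠ v ∧ bad {u, v, w} := by
  classical
  exact Finset.mem_filter

theorem Reliable.card_badVerts_le (hR : Reliable O T bad) (hT : T.Laminar) (hs : s.Sub T)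
    (hc : Children s a b) (hlarge : threshold n < s.verts.card) {u v : Fin n} (huv : u ≠ v) :
    8 * (badVerts bad s u v).card ≤ s.verts.card := by
  obtain ⟨x, y, hxy⟩ : ∃ x y, T.lca {x, y} = s := by
    cases hc <;> exact hs.exists_lca_pair hT
  subst hxy
  exact hR.few x y u v hlarge _ (fun w hw => (mem_badVerts.1 hw).1)
    (fun w hw => (mem_badVerts.1 hw).2) huv

theorem not_bad_of_notMem_badVerts {u v w : Fin n} (hw : w ∈ s.verts) (hwu : w ≠ u)
    (hwv : w ≠ v) (h : w ∉ badVerts bad s u v) : ¬ bad {u, v, w} := fun hb =>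
  h (mem_badVerts.2 ⟨hw, hwu, hwv, hb⟩)

theorem Children.card_add (hc : Children s a b) (hs : s.Laminar) :
    a.verts.card + b.verts.card = s.verts.card := by
  rw [hc.verts_eq, Finset.card_union_of_disjoint (hc.disjoint hs)]

/-- For `u` and `v` on different sides, about as many votes go to `v` as there are vertices on the
side of `u`. -/
theorem Reliable.votes_cross (hR : Reliable O T bad) (hT : T.Laminar) (hs : s.Sub T)
    (hc : Children s a b) (hlarge : threshold n < s.verts.card) {u v : Fin n}
    (hu : u ∈ a.verts) (hv : v ∈ b.verts) :
    8 * votes O false s.verts u v ≤ 8 * a.verts.card + 8 + s.verts.card ∧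
      8 * a.verts.card ≤ 8 * votes O false s.verts u v + 8 + s.verts.card := by
  have hd := Finset.disjoint_left.1 (hc.disjoint (hs.laminar hT))
  have huv : u ≠ v := by rintro rfl; exact hd hu hv
  have hfew := hR.card_badVerts_le hT hs hc hlarge huv
  have hsv := hc.verts_eq
  constructor
  · have : s.verts.filter (fun w => O {u, v, w} = if false then w else v) ⊆
        (a.verts ∪ {v}) ∪ badVerts bad s u v := by
      intro w hw
      simp only [Finset.mem_filter, Bool.false_eq_true, if_false] at hw
      by_contra hcon
      simp only [Finset.mem_union, Finset.mem_singleton, not_or] at hcon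
      obtain ⟨⟨hwa, hwv⟩, hwb⟩ := hcon
      have hwB : w ∈ b.verts := by
        have := hw.1
        rw [hsv, Finset.mem_union] at this
        tauto
      have hwu : w ≠ u := by rintro rfl; exact hwa hu
      have := hR.answer_eq hT hs hc.symm (x := v) (y := w) (z := u) hv hwB hu (Ne.symm hwv)
        (τ := {u, v, w}) (by ext; simp; tauto) (not_bad_of_notMem_badVerts hw.1 hwu hwv hwb)
      exact huv (this.symm.trans hw.2)
    have h1 := Finset.card_le_card this
    have h2 := Finset.card_union_le (a.verts ∪ {v}) (badVerts bad s u v)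
    have h3 := Finset.card_union_le a.verts {v}
    rw [Finset.card_singleton] at h3
    rw [votes]
    omega
  · have : a.verts ⊆ (s.verts.filter (fun w => O {u, v, w} = if false then w else v) ∪ {u}) ∪
        badVerts bad s u v := by
      intro w hw
      by_contra hcon
      simp only [Finset.mem_union, Finset.mem_singleton, not_or, Finset.mem_filter,
        Bool.false_eq_true, if_false] at hcon
      obtain ⟨⟨h1, hwu⟩, hwb⟩ := hcon
      have hwS : w ∈ s.verts := hsv ▸ Finset.mem_union_left _ hw
      have hwv : w ≠ v := by rintro rfl; exact hd hw hv
      exact h1 ⟨hwS, hR.answer_eq hT hs hc (x := u) (y := w) (z := v) hu hw hv (Ne.symm hwu)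
        (by ext; simp; tauto) (not_bad_of_notMem_badVerts hwS hwu hwv hwb)⟩
    have h1 := Finset.card_le_card this
    have h2 := Finset.card_union_le (s.verts.filter (fun w => O {u, v, w} = if false then w else v)
      ∪ {u}) (badVerts bad s u v)
    have h3 := Finset.card_union_le
      (s.verts.filter (fun w => O {u, v, w} = if false then w else v)) {u}
    rw [Finset.card_singleton] at h3
    rw [votes]
    omega

/-- For `u` and `v` on different sides, few vertices `w` get the vote of `{u, v, w}`. -/
theorem Reliable.votes_own_cross (hR : Reliable O T bad) (hT : T.Laminar) (hs : s.Sub T)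
    (hc : Children s a b) (hlarge : threshold n < s.verts.card) {u v : Fin n}
    (hu : u ∈ a.verts) (hv : v ∈ b.verts) :
    8 * votes O true s.verts u v ≤ 16 + s.verts.card := by
  have hd := Finset.disjoint_left.1 (hc.disjoint (hs.laminar hT))
  have huv : u ≠ v := by rintro rfl; exact hd hu hv
  have hfew := hR.card_badVerts_le hT hs hc hlarge huv
  have hsv := hc.verts_eq
  have : s.verts.filter (fun w => O {u, v, w} = if true then w else v) ⊆
      {u, v} ∪ badVerts bad s u v := by
    intro w hw
    simp only [Finset.mem_filter, if_true] at hw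
    by_contra hcon
    simp only [Finset.mem_union, Finset.mem_insert, Finset.mem_singleton, not_or] at hcon
    obtain ⟨⟨hwu, hwv⟩, hwb⟩ := hcon
    have hbad := not_bad_of_notMem_badVerts hw.1 hwu hwv hwb
    have hwS := hw.1
    rw [hsv, Finset.mem_union] at hwS
    rcases hwS with hwa | hwb
    · exact hwv (hw.2.symm.trans (hR.answer_eq hT hs hc (x := u) (y := w) (z := v) hu hwa hv
        (Ne.symm hwu) (by ext; simp; tauto) hbad))
    · exact hwu (hw.2.symm.trans (hR.answer_eq hT hs hc.symm (x := v) (y := w) (z := u) hv hwb hu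
        (Ne.symm hwv) (by ext; simp; tauto) hbad))
  have h1 := Finset.card_le_card this
  have h2 := Finset.card_union_le {u, v} (badVerts bad s u v)
  have h3 : ({u, v} : Finset (Fin n)).card ≤ 2 := Finset.card_le_two
  rw [votes]
  omega

/-- For `u` and `v` on the same side, most vertices `w` of the other side get the vote of
`{u, v, w}`. -/
theorem Reliable.votes_own_same (hR : Reliable O T bad) (hT : T.Laminar) (hs : s.Sub T)
    (hc : Children s a b) (hlarge : threshold n < s.verts.card) {u v : Fin n} (huv : u ≠ v)
    (hu : u ∈ a.verts) (hv : v ∈ a.verts) :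
    8 * b.verts.card ≤ 8 * votes O true s.verts u v + s.verts.card := by
  have hd := Finset.disjoint_left.1 (hc.disjoint (hs.laminar hT))
  have hfew := hR.card_badVerts_le hT hs hc hlarge huv
  have hsv := hc.verts_eq
  have : b.verts ⊆ s.verts.filter (fun w => O {u, v, w} = if true then w else v) ∪
      badVerts bad s u v := by
    intro w hw
    by_contra hcon
    simp only [Finset.mem_union, Finset.mem_filter, if_true, not_or] at hcon
    have hwS : w ∈ s.verts := hsv ▸ Finset.mem_union_right _ hw
    have hwu : w ≠ u := by rintro rfl; exact hd hu hw
    have hwv : w ≠ v := by rintro rfl; exact hd hv hw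
    exact hcon.1 ⟨hwS, hR.answer_eq hT hs hc (x := u) (y := v) (z := w) hu hv hw huv rfl
      (not_bad_of_notMem_badVerts hwS hwu hwv hcon.2)⟩
  have h1 := Finset.card_le_card this
  have h2 := Finset.card_union_le
    (s.verts.filter (fun w => O {u, v, w} = if true then w else v)) (badVerts bad s u v)
  rw [votes]
  omega

end Votes

/-! ### Scanning a segment of an array -/

section Scan

variable {n : ℕ}

/-- The cells `lo, …, hi - 1` of the array `h` list the vertices of `S` without repetition. -/
def Seg (h : ℕ → ℕ) (lo hi : ℕ) (S : Finset (Fin n)) : Prop :=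
  Set.InjOn h (Set.Ico lo hi) ∧ (Finset.Ico lo hi).image h = S.map Fin.valEmbedding

/-- The number of indices `i ∈ [lo, hi)` for which the answer to `u, v, h i` is `h i` (if `own` is
true) or `v` (if `own` is false). -/
def tally (O : Oracle n) (own : Bool) (h : ℕ → ℕ) (lo hi u v : ℕ) : ℕ :=
  ((Finset.Ico lo hi).filter fun i => O.answer u v (h i) = if own then h i else v).card

/-- The state after `d` rounds of a scan of the segment `[lo, hi)`. Round `d` compares the first
cell with the cell `lo + 1 + d` by a vote; a positive vote moves the latter to the position of the
pointer, the second component of the state, which then advances by `inc`. -/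
def scan (O : Oracle n) (own : Bool) (mul inc lo hi : ℕ) (h : ℕ → ℕ) (p : ℕ) :
    ℕ → (ℕ → ℕ) × ℕ
  | 0 => (h, p)
  | d + 1 =>
    let s := scan O own mul inc lo hi h p d
    if hi - lo < mul * tally O own s.1 lo hi (s.1 lo) (s.1 (lo + 1 + d)) then
      (s.1 ∘ Equiv.swap s.2 (lo + 1 + d), s.2 + inc)
    else s

theorem Seg.card_eq {h : ℕ → ℕ} {lo hi : ℕ} {S : Finset (Fin n)} (hs : Seg h lo hi S) :
    S.card = hi - lo := by
  rw [← Finset.card_map Fin.valEmbedding, ← hs.2, Finset.card_image_of_injOn (by simpa using hs.1)]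
  simp

theorem Seg.tally_eq {O : Oracle n} {own : Bool} {h : ℕ → ℕ} {lo hi : ℕ} {S : Finset (Fin n)}
    (hs : Seg h lo hi S) (u v : Fin n) : tally O own h lo hi u v = votes O own S u v := by
  rw [tally, votes, ← Finset.card_map Fin.valEmbedding]
  refine Finset.card_bij (fun i _ => h i) ?_ ?_ ?_
  · intro i hi'
    rw [Finset.mem_filter] at hi'
    have : h i ∈ S.map Fin.valEmbedding := hs.2 ▸ Finset.mem_image_of_mem h hi'.1
    obtain ⟨w, hw, hwi⟩ := Finset.mem_map.1 this
    have hwi' : (w : ℕ) = h i := hwi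
    rw [← hwi'] at hi'
    refine Finset.mem_map.2 ⟨w, Finset.mem_filter.2 ⟨hw, ?_⟩, hwi⟩
    have h2 := hi'.2
    simp only [Oracle.answer, Fin.is_lt, and_self, dite_true] at h2
    apply Fin.ext
    rw [h2]
    split_ifs <;> rfl
  · intro i hi' j hj' hij
    rw [Finset.mem_filter, Finset.mem_Ico] at hi' hj'
    exact hs.1 (Set.mem_Ico.2 hi'.1) (Set.mem_Ico.2 hj'.1) hij
  · intro x hx
    obtain ⟨w, hw, rfl⟩ := Finset.mem_map.1 hx
    rw [Finset.mem_filter] at hw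
    have : Fin.valEmbedding w ∈ (Finset.Ico lo hi).image h := hs.2 ▸ Finset.mem_map_of_mem _ hw.1
    obtain ⟨i, hi', hiw⟩ := Finset.mem_image.1 this
    have hiw' : h i = (w : ℕ) := hiw
    refine ⟨i, Finset.mem_filter.2 ⟨hi', ?_⟩, hiw⟩
    simp only [hiw', Oracle.answer, Fin.is_lt, and_self, dite_true]
    rw [hw.2]
    split_ifs <;> rfl

theorem Seg.comp {h : ℕ → ℕ} {lo hi : ℕ} {S : Finset (Fin n)} (hs : Seg h lo hi S)
    {π : Equiv.Perm ℕ} (hπ : ∀ x, x ∈ Set.Ico lo hi ↔ π x ∈ Set.Ico lo hi) :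
    Seg (h ∘ π) lo hi S := by
  refine ⟨fun x hx y hy hxy => π.injective (hs.1 ((hπ x).1 hx) ((hπ y).1 hy) hxy), ?_⟩
  rw [← hs.2, ← Finset.image_image]
  congr 1
  ext x
  simp only [Finset.mem_image, Finset.mem_Ico]
  constructor
  · rintro ⟨y, hy, rfl⟩
    exact (hπ y).1 hy
  · intro hx
    exact ⟨π.symm x, (hπ _).2 (by simpa using hx), by simp⟩

theorem swap_mem_Ico_iff {lo hi p j : ℕ} (hp : p ∈ Set.Ico lo hi) (hj : j ∈ Set.Ico lo hi)
    (x : ℕ) : x ∈ Set.Ico lo hi ↔ Equiv.swap p j x ∈ Set.Ico lo hi := by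
  rcases eq_or_ne x p with rfl | h1
  · rw [Equiv.swap_apply_left]
    exact iff_of_true hp hj
  rcases eq_or_ne x j with rfl | h2
  · rw [Equiv.swap_apply_right]
    exact iff_of_true hj hp
  rw [Equiv.swap_apply_of_ne_of_ne h1 h2]

theorem scan_pointer {O : Oracle n} {own : Bool} {mul inc lo hi : ℕ} {h : ℕ → ℕ} {p : ℕ}
    (hp' : p ≤ lo + 1) (hinc : inc ≤ 1) (d : ℕ) :
    p ≤ (scan O own mul inc lo hi h p d).2 ∧
      (scan O own mul inc lo hi h p d).2 ≤ lo + 1 + d := by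
  induction d with
  | zero => simp [scan, hp']
  | succ d ih =>
    simp only [scan]
    split_ifs
    · dsimp only
      omega
    · omega

/-- A scan permutes the cells of its segment. -/
theorem exists_scan_eq_comp {O : Oracle n} {own : Bool} {mul inc lo hi : ℕ} {h : ℕ → ℕ} {p : ℕ}
    (hp : lo ≤ p) (hp' : p ≤ lo + 1) (hinc : inc ≤ 1) {d : ℕ} (hd : lo + 1 + d ≤ hi) :
    ∃ π : Equiv.Perm ℕ, (∀ x, x ∈ Set.Ico lo hi ↔ π x ∈ Set.Ico lo hi) ∧
      (∀ x, x ∉ Set.Ico lo hi → π x = x) ∧ (scan O own mul inc lo hi h p d).1 = h ∘ π := by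
  induction d with
  | zero => exact ⟨1, by simp, by simp, rfl⟩
  | succ d ih =>
    obtain ⟨π, h1, h2, h3⟩ := ih (by omega)
    have hpt := scan_pointer (O := O) (own := own) (mul := mul) (hi := hi) (h := h) hp' hinc d
    simp only [scan]
    split_ifs with hc
    · have hP : (scan O own mul inc lo hi h p d).2 ∈ Set.Ico lo hi :=
        Set.mem_Ico.2 ⟨by omega, by omega⟩
      have hJ : lo + 1 + d ∈ Set.Ico lo hi := Set.mem_Ico.2 ⟨by omega, by omega⟩
      refine ⟨(Equiv.swap (scan O own mul inc lo hi h p d).2 (lo + 1 + d)).trans π, ?_, ?_, ?_⟩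
      · intro x
        rw [swap_mem_Ico_iff hP hJ x, h1]
        rfl
      · intro x hx
        have : Equiv.swap (scan O own mul inc lo hi h p d).2 (lo + 1 + d) x = x :=
          Equiv.swap_apply_of_ne_of_ne (by rintro rfl; exact hx hP) (by rintro rfl; exact hx hJ)
        rw [Equiv.trans_apply, this, h2 x hx]
      · simp only [h3, Equiv.coe_trans, Function.comp_assoc]
    · exact ⟨π, h1, h2, h3⟩

theorem scan_apply_of_notMem {O : Oracle n} {own : Bool} {mul inc lo hi : ℕ} {h : ℕ → ℕ} {p : ℕ}
    (hp : lo ≤ p) (hp' : p ≤ lo + 1) (hinc : inc ≤ 1) {d : ℕ} (hd : lo + 1 + d ≤ hi) {x : ℕ}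
    (hx : x ∉ Set.Ico lo hi) : (scan O own mul inc lo hi h p d).1 x = h x := by
  obtain ⟨π, -, h2, h3⟩ := exists_scan_eq_comp (O := O) (own := own) (mul := mul) (h := h)
    hp hp' hinc hd
  rw [h3, Function.comp_apply, h2 x hx]

theorem Seg.scan {O : Oracle n} {own : Bool} {mul inc lo hi : ℕ} {h : ℕ → ℕ} {p : ℕ}
    {S : Finset (Fin n)} (hs : Seg h lo hi S)
    (hp : lo ≤ p) (hp' : p ≤ lo + 1) (hinc : inc ≤ 1) {d : ℕ} (hd : lo + 1 + d ≤ hi) :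
    Seg (HC.scan O own mul inc lo hi h p d).1 lo hi S := by
  obtain ⟨π, h1, h2, h3⟩ := exists_scan_eq_comp (O := O) (own := own) (mul := mul) (h := h)
    hp hp' hinc hd
  rw [h3]
  exact hs.comp h1

theorem Seg.exists_mem {h : ℕ → ℕ} {lo hi : ℕ} {S : Finset (Fin n)} (hs : Seg h lo hi S) {i : ℕ}
    (hi' : i ∈ Set.Ico lo hi) : ∃ v ∈ S, h i = (v : ℕ) := by
  have : h i ∈ S.map Fin.valEmbedding :=
    hs.2 ▸ Finset.mem_image_of_mem h (Finset.mem_Ico.2 (Set.mem_Ico.1 hi'))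
  obtain ⟨w, hw, hwi⟩ := Finset.mem_map.1 this
  exact ⟨w, hw, hwi.symm⟩

theorem Seg.exists_index {h : ℕ → ℕ} {lo hi : ℕ} {S : Finset (Fin n)} (hs : Seg h lo hi S)
    {v : Fin n} (hv : v ∈ S) : ∃ i ∈ Set.Ico lo hi, h i = (v : ℕ) := by
  have : Fin.valEmbedding v ∈ (Finset.Ico lo hi).image h := hs.2 ▸ Finset.mem_map_of_mem _ hv
  obtain ⟨i, hi', hiw⟩ := Finset.mem_image.1 this
  exact ⟨i, Set.mem_Ico.2 (Finset.mem_Ico.1 hi'), hiw⟩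

/-- A tournament: if every vertex of `Q` wins against every other vertex of `S`, then a vertex of
`Q` ends up in the first cell. -/
theorem Seg.scan_tournament {O : Oracle n} {own : Bool} {mul lo hi : ℕ} {h : ℕ → ℕ}
    {S Q : Finset (Fin n)} (hs : Seg h lo hi S) (hlt : lo < hi)
    (hwin : ∀ u ∈ S, ∀ v ∈ Q, u ∉ Q → hi - lo < mul * votes O own S u v)
    (hlose : ∀ u ∈ Q, ∀ v ∈ S, v ∉ Q → ¬ hi - lo < mul * votes O own S u v)
    (hQS : Q ⊆ S) (hQ : Q.Nonempty) :
    ∃ v ∈ Q, (HC.scan O own mul 0 lo hi h lo (hi - lo - 1)).1 lo = (v : ℕ) := by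
  have hptr : ∀ d, (HC.scan O own mul 0 lo hi h lo d).2 = lo := by
    intro d
    induction d with
    | zero => rfl
    | succ d ih => simp only [HC.scan]; split_ifs <;> simp [ih]
  have key : ∀ d, lo + 1 + d ≤ hi →
      (∃ i ∈ Set.Ico lo (lo + 1 + d), ∃ v ∈ Q, (HC.scan O own mul 0 lo hi h lo d).1 i = (v : ℕ)) →
      ∃ v ∈ Q, (HC.scan O own mul 0 lo hi h lo d).1 lo = (v : ℕ) := by
    intro d
    induction d with
    | zero =>
      rintro - ⟨i, hi', hv⟩
      obtain rfl : i = lo := by rw [Set.mem_Ico] at hi'; omega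
      exact hv
    | succ d ih =>
      intro hd hex
      have ih := ih (by omega)
      have hseg := hs.scan (O := O) (own := own) (mul := mul) (p := lo) le_rfl (by omega)
        (Nat.zero_le 1) (d := d) (by omega)
      obtain ⟨u, huS, hu⟩ := hseg.exists_mem (i := lo) (Set.mem_Ico.2 ⟨le_rfl, hlt⟩)
      obtain ⟨v, hvS, hv⟩ := hseg.exists_mem (i := lo + 1 + d) (Set.mem_Ico.2 ⟨by omega, by omega⟩)
      have hp := hptr d
      simp only [HC.scan, hu, hv, hseg.tally_eq, hp] at hex ⊢
      by_cases hc : hi - lo < mul * votes O own S u v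
      · simp only [if_pos hc] at hex ⊢
        simp only [Function.comp_apply, Equiv.swap_apply_left, hv] at hex ⊢
        by_cases hvQ : v ∈ Q
        · exact ⟨v, hvQ, rfl⟩
        have huQ : u ∉ Q := fun huQ => hlose u huQ v hvS hvQ hc
        exfalso
        obtain ⟨i, hi', w, hw, hiw⟩ := hex
        rw [Set.mem_Ico] at hi'
        obtain ⟨x, hx, hux⟩ : ∃ x ∈ Q, (u : ℕ) = (x : ℕ) := by
          rcases eq_or_ne i lo with rfl | h1
          · rw [Equiv.swap_apply_left, hv] at hiw
            exact absurd (Fin.ext hiw ▸ hw) hvQ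
          rcases eq_or_ne i (lo + 1 + d) with rfl | h2
          · rw [Equiv.swap_apply_right, hu] at hiw
            exact ⟨w, hw, hiw⟩
          rw [Equiv.swap_apply_of_ne_of_ne h1 h2] at hiw
          rw [← hu]
          exact ih ⟨i, Set.mem_Ico.2 ⟨hi'.1, by omega⟩, w, hw, hiw⟩
        exact huQ (Fin.ext hux ▸ hx)
      · simp only [if_neg hc] at hex ⊢
        rw [hu] at ih ⊢
        obtain ⟨i, hi', w, hw, hiw⟩ := hex
        rw [Set.mem_Ico] at hi'
        by_cases hil : i = lo + 1 + d
        · subst hil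
          rw [hv] at hiw
          have hvQ : v ∈ Q := Fin.ext hiw ▸ hw
          by_cases huQ : u ∈ Q
          · exact ⟨u, huQ, rfl⟩
          · exact absurd (hwin u huS v hvQ huQ) hc
        · exact ih ⟨i, Set.mem_Ico.2 ⟨hi'.1, by omega⟩, w, hw, hiw⟩
  refine key _ (by omega) ?_
  obtain ⟨v, hv⟩ := hQ
  obtain ⟨i, hi', hiv⟩ := (hs.scan (O := O) (own := own) (mul := mul) (p := lo) le_rfl (by omega)
    (Nat.zero_le 1) (d := hi - lo - 1) (by omega)).exists_index (hQS hv)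
  exact ⟨i, Set.mem_Ico.2 ⟨hi'.1, by rw [Set.mem_Ico] at hi'; omega⟩, v, hv, hiv⟩

/-- A partition: if the votes tell whether a vertex belongs to `Q`, then the scan moves the
vertices of `Q` to the front. -/
theorem Seg.scan_partition {O : Oracle n} {own : Bool} {mul lo hi : ℕ} {h : ℕ → ℕ}
    {S Q : Finset (Fin n)} (hs : Seg h lo hi S) (hlt : lo < hi) {u : Fin n} (hu : h lo = u)
    (huQ : u ∈ Q) (hvote : ∀ v ∈ S, v ≠ u → (hi - lo < mul * votes O own S u v ↔ v ∈ Q))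
    (hQS : Q ⊆ S) {h' : ℕ → ℕ} {p : ℕ}
    (hsc : HC.scan O own mul 1 lo hi h (lo + 1) (hi - lo - 1) = (h', p)) :
    Seg h' lo p Q ∧ Seg h' p hi (S \ Q) := by
  have key : ∀ d, lo + 1 + d ≤ hi →
      (HC.scan O own mul 1 lo hi h (lo + 1) d).1 lo = (u : ℕ) ∧
      (∀ i, lo ≤ i → i < (HC.scan O own mul 1 lo hi h (lo + 1) d).2 →
        ∃ v ∈ Q, (HC.scan O own mul 1 lo hi h (lo + 1) d).1 i = (v : ℕ)) ∧
      (∀ i, (HC.scan O own mul 1 lo hi h (lo + 1) d).2 ≤ i → i < lo + 1 + d →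
        ∃ v ∉ Q, (HC.scan O own mul 1 lo hi h (lo + 1) d).1 i = (v : ℕ)) := by
    intro d
    induction d with
    | zero =>
      intro _
      refine ⟨hu, fun i h1 h2 => ?_, fun i h1 h2 => ?_⟩
      · obtain rfl : i = lo := by simp only [HC.scan] at h2; omega
        exact ⟨u, huQ, hu⟩
      · simp only [HC.scan] at h1
        omega
    | succ d ih =>
      intro hd
      obtain ⟨ih1, ih2, ih3⟩ := ih (by omega)
      have hseg := hs.scan (O := O) (own := own) (mul := mul) (p := lo + 1) (by omega) le_rfl
        (le_refl 1) (d := d) (by omega)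
      have hpt := scan_pointer (O := O) (own := own) (mul := mul) (hi := hi) (h := h)
        (p := lo + 1) le_rfl le_rfl d
      obtain ⟨v, hvS, hv⟩ := hseg.exists_mem (i := lo + 1 + d) (Set.mem_Ico.2 ⟨by omega, by omega⟩)
      have hvu : v ≠ u := by
        rintro rfl
        have := hseg.1 (Set.mem_Ico.2 ⟨by omega, by omega⟩) (Set.mem_Ico.2 ⟨le_rfl, hlt⟩)
          (hv.trans ih1.symm)
        omega
      have hvt := hvote v hvS hvu
      simp only [HC.scan]
      rw [ih1, hv, hseg.tally_eq]
      set σ := HC.scan O own mul 1 lo hi h (lo + 1) d with hσ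
      by_cases hc : hi - lo < mul * votes O own S u v
      · rw [if_pos hc]
        simp only [Function.comp_apply]
        refine ⟨?_, fun i h1 h2 => ?_, fun i h1 h2 => ?_⟩
        · rw [Equiv.swap_apply_of_ne_of_ne (by omega) (by omega), ih1]
        · rcases eq_or_ne i σ.2 with rfl | h3
          · rw [Equiv.swap_apply_left, hv]
            exact ⟨v, hvt.1 hc, rfl⟩
          rw [Equiv.swap_apply_of_ne_of_ne h3 (by omega)]
          exact ih2 i h1 (by omega)
        · rcases eq_or_ne i (lo + 1 + d) with rfl | h3
          · rw [Equiv.swap_apply_right]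
            exact ih3 _ le_rfl (by omega)
          rw [Equiv.swap_apply_of_ne_of_ne (by omega) h3]
          exact ih3 i (by omega) (by omega)
      · rw [if_neg hc]
        refine ⟨ih1, ih2, fun i h1 h2 => ?_⟩
        rcases eq_or_ne i (lo + 1 + d) with rfl | h3
        · exact ⟨v, fun hvQ => hc (hvt.2 hvQ), hv⟩
        · exact ih3 i h1 (by omega)
  obtain ⟨-, k2, k3⟩ := key (hi - lo - 1) (by omega)
  have hseg := hs.scan (O := O) (own := own) (mul := mul) (p := lo + 1) (by omega) le_rfl
    (le_refl 1) (d := hi - lo - 1) (by omega)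
  have hpt := scan_pointer (O := O) (own := own) (mul := mul) (hi := hi) (h := h)
    (p := lo + 1) le_rfl le_rfl (hi - lo - 1)
  rw [hsc] at k2 k3 hseg hpt
  simp only at k2 k3 hseg hpt
  refine ⟨⟨hseg.1.mono (Set.Ico_subset_Ico le_rfl (by omega)), ?_⟩,
    ⟨hseg.1.mono (Set.Ico_subset_Ico (by omega) le_rfl), ?_⟩⟩
  · ext x
    simp only [Finset.mem_image, Finset.mem_Ico, Finset.mem_map]
    constructor
    · rintro ⟨i, hi', rfl⟩
      obtain ⟨v, hv, hiv⟩ := k2 i hi'.1 hi'.2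
      exact ⟨v, hv, hiv.symm⟩
    · rintro ⟨v, hv, rfl⟩
      obtain ⟨i, hi', hiv⟩ := hseg.exists_index (hQS hv)
      rw [Set.mem_Ico] at hi'
      refine ⟨i, ⟨hi'.1, ?_⟩, hiv⟩
      by_contra hcon
      obtain ⟨w, hw, hiw⟩ := k3 i (by omega) (by omega)
      exact hw (Fin.ext (hiv.symm.trans hiw) ▸ hv)
  · ext x
    simp only [Finset.mem_image, Finset.mem_Ico, Finset.mem_map, Finset.mem_sdiff]
    constructor
    · rintro ⟨i, hi', rfl⟩
      obtain ⟨v, hv, hiv⟩ := hseg.exists_mem (i := i) (Set.mem_Ico.2 ⟨by omega, hi'.2⟩)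
      obtain ⟨w, hw, hiw⟩ := k3 i (by omega) (by omega)
      exact ⟨v, ⟨hv, fun hvQ => hw (Fin.ext (hiv.symm.trans hiw) ▸ hvQ)⟩, hiv.symm⟩
    · rintro ⟨v, ⟨hv, hvQ⟩, rfl⟩
      obtain ⟨i, hi', hiv⟩ := hseg.exists_index hv
      rw [Set.mem_Ico] at hi'
      refine ⟨i, ⟨?_, hi'.2⟩, hiv⟩
      by_contra hcon
      obtain ⟨w, hw, hiw⟩ := k2 i (by omega) (by omega)
      exact hvQ (Fin.ext (hiv.symm.trans hiw) ▸ hw)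

open ClusterTree in
/-- The two scans of the segment of a large cluster find the root split of the cluster: the
tournament selects a vertex `u` such that at least a third of the cluster is on the other side, and
by the votes of the other side the partition then recognizes the vertices on the side of `u`. -/
theorem Reliable.split {O : Oracle n} {T s : ClusterTree n} {bad : Finset (Fin n) → Prop}
    (hR : Reliable O T bad) (hT : T.IsHCTree) (hn : 2 ≤ n) (hs : s.Sub T) {h h₁ h₂ : ℕ → ℕ}
    {lo hi p₁ p₂ : ℕ} (hseg : Seg h lo hi s.verts) (hlarge : threshold n < hi - lo)
    (h1 : scan O false 2 0 lo hi h lo (hi - lo - 1) = (h₁, p₁))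
    (h2 : scan O true 6 1 lo hi h₁ (lo + 1) (hi - lo - 1) = (h₂, p₂)) :
    ∃ a b, Children s a b ∧ Seg h₂ lo p₂ a.verts ∧ Seg h₂ p₂ hi b.verts := by
  have hlam := hs.laminar hT.1
  have hcard := hseg.card_eq
  have h30 := threshold_pos hn
  rw [← hcard] at hlarge
  obtain ⟨a₀, b₀, hc₀⟩ : ∃ a b, Children s a b := by
    cases s with
    | leaf X =>
      have := hT.2.2 X (HasLeaf.of_sub (by simp [HasLeaf]) hs)
      simp only [verts] at hlarge
      omega
    | node l r => exact ⟨l, r, .left l r⟩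
  have hlt : lo < hi := by omega
  have hseg1 : Seg h₁ lo hi s.verts := by
    have := hseg.scan (O := O) (own := false) (mul := 2) (p := lo) le_rfl (by omega)
      (Nat.zero_le 1) (d := hi - lo - 1) (by omega)
    rwa [h1] at this
  -- A side with less than a third of the vertices wins the tournament.
  have hsmall : ∀ a b, Children s a b → 3 * a.verts.card < s.verts.card →
      ∃ v ∈ a.verts, h₁ lo = (v : ℕ) := by
    intro a b hc hab
    have hsum := Children.card_add hc hlam
    have hmem : ∀ {x}, x ∈ s.verts → x ∉ a.verts → x ∈ b.verts := fun hx hxa => by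
      rw [hc.verts_eq, Finset.mem_union] at hx
      tauto
    have := hseg.scan_tournament (O := O) (own := false) (mul := 2) (Q := a.verts) hlt ?_ ?_
      hc.sub_fst.verts_subset (hc.sub_fst.laminar hlam).verts_nonempty
    · rwa [h1] at this
    · intro u hu v hv hua
      have := (hR.votes_cross hT.1 hs hc.symm hlarge (hmem hu hua) hv).2
      omega
    · intro u hu v hv hva
      have := (hR.votes_cross hT.1 hs hc hlarge hu (hmem hv hva)).1
      omega
  obtain ⟨u, huS, hu⟩ := hseg1.exists_mem (i := lo) (Set.mem_Ico.2 ⟨le_rfl, hlt⟩)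
  obtain ⟨a, b, hc, hua⟩ : ∃ a b, Children s a b ∧ u ∈ a.verts := by
    rw [hc₀.verts_eq, Finset.mem_union] at huS
    rcases huS with h | h
    · exact ⟨a₀, b₀, hc₀, h⟩
    · exact ⟨b₀, a₀, hc₀.symm, h⟩
  have hd := hc.disjoint hlam
  have hb : s.verts.card ≤ 3 * b.verts.card := by
    by_contra hcon
    obtain ⟨v, hv, hv'⟩ := hsmall b a hc.symm (by omega)
    exact Finset.disjoint_left.1 hd hua (Fin.ext (hu.symm.trans hv') ▸ hv)
  have hpart := hseg1.scan_partition (O := O) (own := true) (mul := 6) (Q := a.verts) hlt hu hua ?_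
    hc.sub_fst.verts_subset h2
  · refine ⟨a, b, hc, hpart.1, ?_⟩
    convert hpart.2 using 1
    rw [hc.verts_eq, Finset.union_sdiff_cancel_left hd]
  · intro v hv hvu
    constructor
    · intro hvote
      by_contra hva
      have hvb : v ∈ b.verts := by
        rw [hc.verts_eq, Finset.mem_union] at hv
        tauto
      have := hR.votes_own_cross hT.1 hs hc hlarge hua hvb
      omega
    · intro hva
      have := hR.votes_own_same hT.1 hs hc hlarge hvu.symm hua hva
      omega

end Scan

/-! ### A program logic for coin-free programs -/

section Logic

variable {n : ℕ} {w A : ℕ} {O : Oracle n}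

theorem runFrom_succ_pure {s s' : Config} (h : step w O s = PMF.pure s') (t : ℕ) :
    runFrom w O (t + 1) s = runFrom w O t s' := by
  rw [runFrom, h, PMF.pure_bind]

theorem runFrom_of_todo_nil {s : Config} (h : s.todo = []) (t : ℕ) :
    runFrom w O t s = PMF.pure s := by
  induction t with
  | zero => rfl
  | succ t ih =>
    rw [runFrom_succ_pure (s' := s) (by simp [step, h]), ih]

/-- `Reaches w A O c Q m t q`: the command `c`, started with memory `m` at time `t` after `q`
queries, terminates for all outcomes of the coins in one and the same memory, which together with
the new time and number of queries satisfies `Q`; all accesses are to addresses below `A`, the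
number of words that are in use already. -/
def Reaches (w A : ℕ) (O : Oracle n) (c : Cmd) (Q : (ℕ → ℕ) → ℕ → ℕ → Prop)
    (m : ℕ → ℕ) (t q : ℕ) : Prop :=
  ∃ m' t' q', Q m' (t + t') q' ∧ ∀ K u,
    runFrom w O (t' + u) ⟨c :: K, m, q, A⟩ = runFrom w O u ⟨K, m', q', A⟩

variable {Q Q' : (ℕ → ℕ) → ℕ → ℕ → Prop} {m : ℕ → ℕ} {t q : ℕ}

theorem Reaches.mono {c : Cmd} (h : Reaches w A O c Q m t q)
    (hQ : ∀ m t q, Q m t q → Q' m t q) : Reaches w A O c Q' m t q := by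
  obtain ⟨m', t', q', h1, h2⟩ := h
  exact ⟨m', t', q', hQ _ _ _ h1, h2⟩

theorem Reaches.of_step {c : Cmd} {m' : ℕ → ℕ} {q' : ℕ} (hQ : Q m' (t + 1) q')
    (h : ∀ K, step w O ⟨c :: K, m, q, A⟩ = PMF.pure ⟨K, m', q', A⟩) :
    Reaches w A O c Q m t q :=
  ⟨m', 1, q', hQ, fun K u => by rw [add_comm, runFrom_succ_pure (h K)]⟩

theorem Reaches.step {c c' : Cmd}
    (h : ∀ K, HC.step w O ⟨c :: K, m, q, A⟩ = PMF.pure ⟨c' :: K, m, q, A⟩)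
    (h' : Reaches w A O c' Q m (t + 1) q) : Reaches w A O c Q m t q := by
  obtain ⟨m', t', q', h1, h2⟩ := h'
  refine ⟨m', t' + 1, q', by rwa [add_assoc, add_comm 1] at h1, fun K u => ?_⟩
  rw [add_right_comm, runFrom_succ_pure (h K), h2]

theorem Reaches.seq {c d : Cmd}
    (h : Reaches w A O c (fun m t q => Reaches w A O d Q m t q) m (t + 1) q) :
    Reaches w A O (.seq c d) Q m t q := by
  obtain ⟨m₁, t₁, q₁, ⟨m₂, t₂, q₂, hQ, h2⟩, h1⟩ := h
  refine ⟨m₂, t₁ + t₂ + 1, q₂, by convert hQ using 1; ring, fun K u => ?_⟩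
  rw [add_right_comm, runFrom_succ_pure (s' := ⟨c :: d :: K, m, q, A⟩)
    (by simp [HC.step, Config.goto]), add_assoc, h1, h2]

/-- The rule for loops with an invariant and a measure that decreases. -/
theorem Reaches.loop {a b : ℕ} {p : Cmd} {Inv : (ℕ → ℕ) → ℕ → ℕ → Prop} (μ : (ℕ → ℕ) → ℕ)
    (ha : a < A) (hb : b < A)
    (hbody : ∀ m t q, Inv m t q → m a < m b →
      Reaches w A O p (fun m' t' q' => Inv m' t' q' ∧ μ m' < μ m) m (t + 1) q)
    (hexit : ∀ m t q, Inv m t q → ¬ m a < m b → Q m (t + 1) q)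
    (h : Inv m t q) : Reaches w A O (.loop a b p) Q m t q := by
  have hA : max (a + 1) (max (b + 1) A) = A := by omega
  induction hk : μ m using Nat.strong_induction_on generalizing m t q with
  | _ k ih =>
    by_cases hc : m a < m b
    · obtain ⟨m₁, t₁, q₁, ⟨hI, hμ⟩, h1⟩ := hbody m t q h hc
      obtain ⟨m₂, t₂, q₂, hQ, h2⟩ := ih (μ m₁) (hk ▸ hμ) hI rfl
      refine ⟨m₂, t₁ + t₂ + 1, q₂, by convert hQ using 1; ring, fun K u => ?_⟩
      rw [add_right_comm, runFrom_succ_pure (s' := ⟨p :: .loop a b p :: K, m, q, A⟩)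
        (by simp [HC.step, Config.goto, hc, hA]), add_assoc, h1, h2]
    · exact .of_step (hexit m t q h hc) fun K => by simp [HC.step, Config.goto, hc, hA]

/-- The weakest precondition of a command; loops are left alone. -/
def pre (w A : ℕ) (O : Oracle n) : Cmd → ((ℕ → ℕ) → ℕ → ℕ → Prop) → (ℕ → ℕ) → ℕ → ℕ → Prop
  | .skip, Q, m, t, q => Q m (t + 1) q
  | .const d k, Q, m, t, q => d < A ∧ k < 2 ^ w ∧ Q (Function.update m d k) (t + 1) q
  | .arith o d a b, Q, m, t, q => d < A ∧ a < A ∧ b < A ∧ o.eval (m a) (m b) < 2 ^ w ∧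
      Q (Function.update m d (o.eval (m a) (m b))) (t + 1) q
  | .load d a, Q, m, t, q => d < A ∧ a < A ∧ m a < A ∧
      Q (Function.update m d (m (m a))) (t + 1) q
  | .store a b, Q, m, t, q => a < A ∧ b < A ∧ m a < A ∧
      Q (Function.update m (m a) (m b)) (t + 1) q
  | .query d a b c, Q, m, t, q => d < A ∧ a < A ∧ b < A ∧ c < A ∧
      Q (Function.update m d (O.answer (m a) (m b) (m c))) (t + 1) (q + 1)
  | .seq c d, Q, m, t, q => pre w A O c (pre w A O d Q) m (t + 1) q
  | .ite a b c d, Q, m, t, q => a < A ∧ b < A ∧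
      (m a < m b → pre w A O c Q m (t + 1) q) ∧ (¬ m a < m b → pre w A O d Q m (t + 1) q)
  | c, Q, m, t, q => Reaches w A O c Q m t q

theorem Reaches.of_pre {c : Cmd} (h : pre w A O c Q m t q) : Reaches w A O c Q m t q := by
  induction c generalizing Q m t q with
  | skip => exact .of_step h fun K => by simp [HC.step, Config.goto]
  | const d k =>
    obtain ⟨h1, h2, h⟩ := h
    have hA : max (d + 1) A = A := by omega
    refine .of_step h fun K => ?_
    simp [hA, HC.step, Config.goto, Config.write, Nat.mod_eq_of_lt h2]
  | arith o d a b =>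
    obtain ⟨h1, h2, h3, h4, h⟩ := h
    have hA : max (d + 1) (max (a + 1) (max (b + 1) A)) = A := by omega
    refine .of_step h fun K => ?_
    simp [hA, HC.step, Config.goto, Config.write, Nat.mod_eq_of_lt h4]
  | load d a =>
    obtain ⟨h1, h2, h3, h⟩ := h
    have hA : max (d + 1) (max (a + 1) (max (m a + 1) A)) = A := by omega
    refine .of_step h fun K => ?_
    simp [hA, HC.step, Config.goto, Config.write]
  | store a b =>
    obtain ⟨h1, h2, h3, h⟩ := h
    have hA : max (m a + 1) (max (a + 1) (max (b + 1) A)) = A := by omega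
    refine .of_step h fun K => ?_
    simp [hA, HC.step, Config.goto, Config.write]
  | rand d a => exact h
  | query d a b c =>
    obtain ⟨h1, h2, h3, h4, h⟩ := h
    have hA : max (d + 1) (max (a + 1) (max (b + 1) (max (c + 1) A))) = A := by omega
    refine .of_step h fun K => ?_
    simp [hA, HC.step, Config.goto, Config.write]
  | seq c d ihc ihd => exact .seq ((ihc h).mono fun m t q => ihd)
  | ite a b c d ihc ihd =>
    obtain ⟨h1, h2, h3, h4⟩ := h
    have hA : max (a + 1) (max (b + 1) A) = A := by omega
    by_cases hc : m a < m b
    · exact .step (fun K => by simp [HC.step, Config.goto, hc, hA]) (ihc (h3 hc))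
    · exact .step (fun K => by simp [HC.step, Config.goto, hc, hA]) (ihd (h4 hc))
  | loop a b p _ => exact h

end Logic

/-! ### The program that scans a segment -/

/- Addresses of the registers. -/
local notation "rN" => (0 : ℕ)
local notation "rOne" => (1 : ℕ)
local notation "rK" => (2 : ℕ)
local notation "rSize" => (3 : ℕ)
local notation "rLo" => (4 : ℕ)
local notation "rHi" => (5 : ℕ)
local notation "rP" => (6 : ℕ)
local notation "rJ" => (7 : ℕ)
local notation "rI" => (8 : ℕ)
local notation "rU" => (9 : ℕ)
local notation "rV" => (10 : ℕ)
local notation "rW" => (11 : ℕ)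
local notation "rAns" => (12 : ℕ)
local notation "rCnt" => (13 : ℕ)
local notation "rT" => (14 : ℕ)
local notation "rCur" => (15 : ℕ)
local notation "rTop" => (16 : ℕ)
local notation "rX" => (17 : ℕ)
local notation "rMul" => (18 : ℕ)
local notation "rInc" => (19 : ℕ)
/- The first address that is not a register. -/
local notation "heap" => (32 : ℕ)

/-- Sequential composition of a list of commands. -/
def block : List Cmd → Cmd
  | [] => .skip
  | [c] => c
  | c :: d :: l => .seq c (block (d :: l))

/-- Add to `rCnt` the tally of the segment `[rI, rHi)` for the vertices in `rU` and `rV`. Equality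
of the answer with the expected vertex is tested by two strict comparisons. -/
def tallyCmd (own : Bool) : Cmd :=
  .loop rI rHi <| block [
    .load rW rI,
    .query rAns rU rV rW,
    .ite rAns (if own then rW else rV) .skip
      (.ite (if own then rW else rV) rAns .skip (.arith .add rCnt rCnt rOne)),
    .arith .add rI rI rOne]

/-- Evaluate a vote: if the tally, weighted by `rMul`, exceeds `rSize`, then exchange the cells
`rP` and `rJ` and advance `rP` by `rInc`. In any case advance `rJ`. -/
def moveCmd : Cmd :=
  block [
    .arith .mul rCnt rCnt rMul,
    .ite rSize rCnt
      (block [.load rT rP, .store rP rV, .store rJ rT, .arith .add rP rP rInc])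
      .skip,
    .arith .add rJ rJ rOne]

/-- The program for `scan`. -/
def scanCmd (own : Bool) : Cmd :=
  block [
    .arith .add rJ rLo rOne,
    .loop rJ rHi <| block [
      .load rU rLo,
      .load rV rJ,
      .const rCnt 0,
      .arith .mul rI rLo rOne,
      tallyCmd own,
      moveCmd]]

section

variable {n : ℕ} {w A : ℕ} {O : Oracle n}

theorem tally_le (own : Bool) (h : ℕ → ℕ) (lo hi u v : ℕ) :
    tally O own h lo hi u v ≤ hi - lo := by
  refine (Finset.card_filter_le _ _).trans ?_
  simp

theorem tally_succ (own : Bool) (h : ℕ → ℕ) {lo i : ℕ} (hi : lo ≤ i) (u v : ℕ) :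
    tally O own h lo (i + 1) u v = tally O own h lo i u v +
      if O.answer u v (h i) = (if own then h i else v) then 1 else 0 := by
  rw [tally, tally, ← Finset.insert_Ico_right_eq_Ico_add_one hi, Finset.filter_insert]
  split_ifs <;> simp

theorem tally_congr (own : Bool) {h h' : ℕ → ℕ} {lo hi : ℕ} (hh : ∀ i, lo ≤ i → i < hi → h i = h' i)
    (u v : ℕ) : tally O own h lo hi u v = tally O own h' lo hi u v := by
  rw [tally, tally]
  congr 1
  refine Finset.filter_congr fun i hi => ?_
  rw [Finset.mem_Ico] at hi
  rw [hh i hi.1 hi.2]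

variable {Q : (ℕ → ℕ) → ℕ → ℕ → Prop} {m : ℕ → ℕ} {t q : ℕ}

theorem reaches_tallyCmd (own : Bool) {lo hi : ℕ} (hlo : heap ≤ lo) (hlt : lo ≤ hi) (hhi : hi ≤ A)
    (hA : heap ≤ A) (hw : 6 * A < 2 ^ w) (h1 : m rOne = 1) (hI : m rI = lo) (hH : m rHi = hi)
    (hC : m rCnt = 0)
    (hQ : ∀ m' t' q', (∀ a, a < rI ∨ a = rU ∨ a = rV ∨ rT ≤ a → m' a = m a) →
      m' rCnt = tally O own m lo hi (m rU) (m rV) →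
      t' ≤ t + 12 * (hi - lo) + 1 → q' ≤ q + (hi - lo) → Q m' t' q') :
    Reaches w A O (tallyCmd own) Q m t q := by
  refine Reaches.loop (μ := fun m' => hi - m' rI)
    (Inv := fun m' t' q' => (∀ a, a < rI ∨ a = rU ∨ a = rV ∨ rT ≤ a → m' a = m a) ∧
      lo ≤ m' rI ∧ m' rI ≤ hi ∧ m' rCnt = tally O own m lo (m' rI) (m rU) (m rV) ∧
      t' ≤ t + 12 * (m' rI - lo) ∧ q' ≤ q + (m' rI - lo)) (by omega) (by omega) ?_ ?_ ?_
  · rintro m' t' q' ⟨hf, hl, hh, hc, ht, hq⟩ hlt'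
    have e1 : m' rOne = 1 := by rw [hf _ (by omega), h1]
    have e2 : m' rHi = hi := by rw [hf _ (by omega), hH]
    have e3 : m' rU = m rU := hf _ (by omega)
    have e4 : m' rV = m rV := hf _ (by omega)
    have e5 : m' (m' rI) = m (m' rI) := hf _ (by omega)
    rw [e2] at hlt'
    have hs := tally_succ (O := O) own m hl (m rU) (m rV)
    have hle := tally_le (O := O) own m lo (m' rI) (m rU) (m rV)
    have hsel : (if own then rW else rV) < A := by split_ifs <;> omega
    refine Reaches.of_pre ?_
    simp only [block, pre, Arith.eval]
    cases own
    all_goals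
      simp (disch := omega) only [Function.update_self, Function.update_of_ne, if_true, if_false,
        Bool.false_eq_true, e1, e3, e4, e5] at hsel hs ⊢
      refine ⟨by omega, by omega, by omega, by omega, by omega, by omega, by omega, by omega,
        by omega, fun hlt1 => ⟨by omega, by omega, by omega, by omega, ?_⟩, fun hlt1 =>
        ⟨by omega, by omega, fun hlt2 => ⟨by omega, by omega, by omega, by omega, ?_⟩, fun hlt2 =>
          ⟨by omega, by omega, by omega, by omega, by omega, by omega, by omega, by omega, ?_⟩⟩⟩
    all_goals
      simp only [hc]
      first | rw [if_neg (by omega)] at hs | rw [if_pos (by omega)] at hs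
      refine ⟨⟨fun a ha => ?_, by omega, by omega, by omega, by omega, by omega⟩, by omega⟩
      simp (disch := omega) only [Function.update_of_ne, hf a ha]
  · rintro m' t' q' ⟨hf, hl, hh, hc, ht, hq⟩ hlt'
    have e2 : m' rHi = hi := by rw [hf _ (by omega), hH]
    have e3 : m' rI = hi := by omega
    rw [e3] at hc ht hq
    exact hQ m' _ _ hf hc (by omega) hq
  · refine ⟨fun _ _ => rfl, hI.ge, hI.trans_le hlt, ?_, by omega, by omega⟩
    rw [hC, hI]
    simp [tally]

theorem pre_tallyCmd (own : Bool) :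
    pre w A O (tallyCmd own) Q m t q = Reaches w A O (tallyCmd own) Q m t q := rfl

theorem pre_moveCmd {p j : ℕ} (hp : heap ≤ p) (hpj : p ≤ j) (hj : j < A)
    (hw : 6 * A < 2 ^ w) (h1 : m rOne = 1) (hP : m rP = p) (hJ : m rJ = j)
    (hc : m rCnt * m rMul < 6 * A) (hinc : m rInc ≤ 1)
    (hpos : m rSize < m rCnt * m rMul → ∀ m' t', (∀ a, a < rP ∨ rCur ≤ a ∧ a < heap → m' a = m a) →
      m' rJ = j + 1 → m' rP = p + m rInc → (∀ a, heap ≤ a → m' a = (m ∘ Equiv.swap p j) a) →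
      t' ≤ t + 16 → Q m' t' q)
    (hneg : ¬ m rSize < m rCnt * m rMul → ∀ m' t',
      (∀ a, a < rP ∨ rCur ≤ a ∧ a < heap → m' a = m a) →
      m' rJ = j + 1 → m' rP = p → (∀ a, heap ≤ a → m' a = m a) → t' ≤ t + 16 → Q m' t' q)
    (hV : m rV = m j) : pre w A O moveCmd Q m t q := by
  simp only [moveCmd, block, pre, Arith.eval]
  simp (disch := omega) only [Function.update_self, Function.update_of_ne, h1, hP, hJ]
  refine ⟨by omega, by omega, by omega, by omega, by omega, by omega, fun hgt =>
    ⟨by omega, by omega, by omega, by omega, by omega, by omega, by omega, by omega, by omega,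
      by omega, by omega, by omega, by omega, by omega, by omega, by omega, by omega,
      hpos hgt _ _ (fun a ha => ?_) ?_ ?_ (fun a ha => ?_) (by omega)⟩, fun hgt =>
    ⟨by omega, by omega, by omega, by omega,
      hneg hgt _ _ (fun a ha => ?_) ?_ ?_ (fun a ha => ?_) (by omega)⟩⟩
  · simp (disch := omega) only [Function.update_of_ne]
  · simp only [Function.update_self]
  · simp (disch := omega) only [Function.update_self, Function.update_of_ne]
  · simp (disch := omega) only [Function.update_of_ne, Function.comp_apply]
    rcases eq_or_ne a j with rfl | h1
    · rw [Function.update_self, Equiv.swap_apply_right]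
    rw [Function.update_of_ne h1]
    rcases eq_or_ne a p with rfl | h2
    · rw [Function.update_self, Equiv.swap_apply_left, hV]
    rw [Function.update_of_ne h2, Equiv.swap_apply_of_ne_of_ne h2 h1]
    simp (disch := omega) only [Function.update_of_ne]
  · simp (disch := omega) only [Function.update_of_ne]
  · simp only [Function.update_self]
  · simp (disch := omega) only [Function.update_of_ne, hP]
  · simp (disch := omega) only [Function.update_of_ne]

theorem pre_scanCmd (own : Bool) {lo hi p mul inc : ℕ} (hlo : heap ≤ lo) (hlt : lo < hi)
    (hhi : hi ≤ A) (hw : 6 * A < 2 ^ w) (hp : lo ≤ p) (hp' : p ≤ lo + 1) (hmul : mul ≤ 6)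
    (hinc : inc ≤ 1) (h1 : m rOne = 1) (hS : m rSize = hi - lo) (hL : m rLo = lo) (hH : m rHi = hi)
    (hP : m rP = p) (hM : m rMul = mul) (hN : m rInc = inc) {h : ℕ → ℕ}
    (hh : ∀ a, heap ≤ a → m a = h a)
    (hQ : ∀ m' t' q', (∀ a, a < rP ∨ rCur ≤ a ∧ a < heap → m' a = m a) →
      m' rP = (scan O own mul inc lo hi h p (hi - lo - 1)).2 →
      (∀ a, heap ≤ a → m' a = (scan O own mul inc lo hi h p (hi - lo - 1)).1 a) →
      t' ≤ t + (hi - lo) * (12 * (hi - lo) + 40) → q' ≤ q + (hi - lo) * (hi - lo) → Q m' t' q') :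
    pre w A O (scanCmd own) Q m t q := by
  simp only [scanCmd, block, pre, Arith.eval, h1, hL]
  refine ⟨by omega, by omega, by omega, by omega, ?_⟩
  refine Reaches.loop (μ := fun m' => hi - m' rJ)
    (Inv := fun m' t' q' => (∀ a, a < rP ∨ rCur ≤ a ∧ a < heap → m' a = m a) ∧
      ∃ d, m' rJ = lo + 1 + d ∧ lo + 1 + d ≤ hi ∧ m' rP = (scan O own mul inc lo hi h p d).2 ∧
      (∀ a, heap ≤ a → m' a = (scan O own mul inc lo hi h p d).1 a) ∧
      t' ≤ t + 2 + d * (12 * (hi - lo) + 40) ∧ q' ≤ q + d * (hi - lo))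
    (by omega) (by omega) ?_ ?_ ?_
  · rintro m₁ t₁ q₁ ⟨hf, d, hJ, hd, hP₁, hheap, ht₁, hq₁⟩ hlt₁
    have e1 : m₁ rOne = 1 := by rw [hf _ (by omega), h1]
    have e2 : m₁ rHi = hi := by rw [hf _ (by omega), hH]
    have e3 : m₁ rLo = lo := by rw [hf _ (by omega), hL]
    have e4 : m₁ rMul = mul := by rw [hf _ (by omega), hM]
    have e5 : m₁ rInc = inc := by rw [hf _ (by omega), hN]
    have e6 : m₁ rSize = hi - lo := by rw [hf _ (by omega), hS]
    have hpt := scan_pointer (O := O) (own := own) (mul := mul) (hi := hi) (h := h) hp' hinc d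
    have hscan : scan O own mul inc lo hi h p (d + 1) =
      let s := scan O own mul inc lo hi h p d
      if hi - lo < mul * tally O own s.1 lo hi (s.1 lo) (s.1 (lo + 1 + d)) then
        (s.1 ∘ Equiv.swap s.2 (lo + 1 + d), s.2 + inc)
      else s := rfl
    set σ := scan O own mul inc lo hi h p d with hσ
    refine Reaches.of_pre ?_
    simp only [pre, Arith.eval, pre_tallyCmd]
    simp (disch := omega) only [Function.update_of_ne, e1, e3, hJ, mul_one]
    refine ⟨by omega, by omega, by omega, by omega, by omega, by omega, by omega, by positivity,
      by omega, by omega, by omega, by omega, ?_⟩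
    refine reaches_tallyCmd own hlo hlt.le hhi (by omega) hw
      (by simp (disch := omega) only [Function.update_of_ne, e1])
      (by simp only [Function.update_self])
      (by simp (disch := omega) only [Function.update_of_ne, e2])
      (by simp (disch := omega) only [Function.update_self, Function.update_of_ne]) ?_
    intro m₂ t₂ q₂ hf₂ hc₂ ht₂ hq₂
    simp (disch := omega) only [Function.update_self, Function.update_of_ne] at hc₂
    rw [tally_congr (h' := σ.1) own (fun i hi1 hi2 => by
      simp (disch := omega) only [Function.update_of_ne]
      exact hheap i (by omega)), hheap _ hlo, hheap _ (by omega)] at hc₂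
    have hle := tally_le (O := O) own σ.1 lo hi (σ.1 lo) (σ.1 (lo + 1 + d))
    set c := tally O own σ.1 lo hi (σ.1 lo) (σ.1 (lo + 1 + d)) with hc
    have hscan' : scan O own mul inc lo hi h p (d + 1) = if hi - lo < mul * c then
        (σ.1 ∘ Equiv.swap σ.2 (lo + 1 + d), σ.2 + inc) else σ := hscan
    have hcm : mul * c ≤ 6 * (hi - lo) := Nat.mul_le_mul hmul hle
    have hcomm : c * mul = mul * c := Nat.mul_comm _ _
    have f1 : m₂ rOne = 1 := by
      rw [hf₂ _ (by omega)]; simp (disch := omega) only [Function.update_of_ne, e1]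
    have f2 : m₂ rMul = mul := by
      rw [hf₂ _ (by omega)]; simp (disch := omega) only [Function.update_of_ne, e4]
    have f3 : m₂ rInc = inc := by
      rw [hf₂ _ (by omega)]; simp (disch := omega) only [Function.update_of_ne, e5]
    have f4 : m₂ rSize = hi - lo := by
      rw [hf₂ _ (by omega)]; simp (disch := omega) only [Function.update_of_ne, e6]
    have f5 : m₂ rP = σ.2 := by
      rw [hf₂ _ (by omega)]; simp (disch := omega) only [Function.update_of_ne, hP₁]
    have f6 : m₂ rJ = lo + 1 + d := by
      rw [hf₂ _ (by omega)]; simp (disch := omega) only [Function.update_of_ne, hJ]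
    have f7 : m₂ rV = σ.1 (lo + 1 + d) := by
      rw [hf₂ _ (by omega)]
      simp (disch := omega) only [Function.update_self, Function.update_of_ne]
      exact hheap _ (by omega)
    have f8 : ∀ a, heap ≤ a → m₂ a = σ.1 a := by
      intro a ha
      rw [hf₂ _ (by omega)]
      simp (disch := omega) only [Function.update_of_ne]
      exact hheap _ ha
    have f9 : ∀ a, a < rP ∨ rCur ≤ a ∧ a < heap → m₂ a = m a := by
      intro a ha
      rw [hf₂ _ (by omega)]
      simp (disch := omega) only [Function.update_of_ne]
      exact hf _ ha
    have ht₃ : t₂ + 16 ≤ t + 2 + (d + 1) * (12 * (hi - lo) + 40) := by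
      rw [Nat.succ_mul]
      omega
    have hq₃ : q₂ ≤ q + (d + 1) * (hi - lo) := by
      rw [Nat.succ_mul]
      omega
    rw [hJ, e2] at hlt₁
    refine (pre_moveCmd (p := σ.2) (j := lo + 1 + d) (by omega) (by omega) (by omega) hw f1 f5 f6
      (by rw [hc₂, f2]; omega) (by omega) ?_ ?_ (by rw [f7, f8 _ (by omega)]))
    · rw [f4, hc₂, f2, hcomm, f3]
      intro hgt m₃ t₃ g1 g2 g3 g4 ht
      refine ⟨⟨fun a ha => (g1 a ha).trans (f9 a ha), d + 1, by omega, by omega, ?_, fun a ha => ?_,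
        by omega, hq₃⟩, by omega⟩
      · rw [hscan', if_pos hgt, g3]
      · rw [hscan', if_pos hgt, g4 a ha]
        refine f8 _ ?_
        rcases eq_or_ne a (lo + 1 + d) with rfl | h1
        · rw [Equiv.swap_apply_right]
          omega
        rcases eq_or_ne a σ.2 with rfl | h2
        · rw [Equiv.swap_apply_left]
          omega
        rwa [Equiv.swap_apply_of_ne_of_ne h2 h1]
    · rw [f4, hc₂, f2, hcomm]
      intro hgt m₃ t₃ g1 g2 g3 g4 ht
      refine ⟨⟨fun a ha => (g1 a ha).trans (f9 a ha), d + 1, by omega, by omega, ?_, fun a ha => ?_,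
        by omega, hq₃⟩, by omega⟩
      · rw [hscan', if_neg hgt, g3]
      · rw [hscan', if_neg hgt, g4 a ha]
        exact f8 a ha
  · rintro m₁ t₁ q₁ ⟨hf, d, hJ, hd, hP₁, hheap, ht₁, hq₁⟩ hlt₁
    have e2 : m₁ rHi = hi := by rw [hf _ (by omega), hH]
    obtain rfl : d = hi - lo - 1 := by omega
    have hd' : hi - lo = (hi - lo - 1) + 1 := by omega
    refine hQ m₁ _ _ hf hP₁ hheap ?_ ?_
    · refine le_trans (Nat.succ_le_succ ht₁) ?_
      conv_rhs => rw [hd', Nat.succ_mul]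
      rw [← hd']
      omega
    · refine hq₁.trans (Nat.add_le_add_left (Nat.mul_le_mul_right _ (Nat.sub_le _ _)) _)
  · refine ⟨fun a ha => by simp (disch := omega) only [Function.update_of_ne], 0, ?_, by omega, ?_,
      fun a ha => ?_, by omega, by omega⟩
    · simp
    · simp (disch := omega) only [Function.update_of_ne, hP, scan]
    · simp (disch := omega) only [Function.update_of_ne, scan, hh a ha]

end

/-! ### The layout of the partial tree in the memory -/

section Layout

variable {n : ℕ}

/-- The array of the vertices occupies the cells from `heap` on; it is followed by `c` records of
three cells. A record that begins with `k ≠ 0` is a leaf that owns a segment of `k` cells of the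
array, a record that begins with `0` is an internal node. -/
structure Layout (n : ℕ) (h : ℕ → ℕ) (c : ℕ) : Prop where
  bound : ∀ i < c, h (heap + n + 3 * i) ≠ 0 → heap ≤ h (heap + n + 3 * i + 1) ∧
    h (heap + n + 3 * i + 1) + h (heap + n + 3 * i) ≤ heap + n
  disjoint : ∀ i < c, ∀ j < c, i ≠ j → h (heap + n + 3 * i) ≠ 0 → h (heap + n + 3 * j) ≠ 0 →
    h (heap + n + 3 * i + 1) + h (heap + n + 3 * i) ≤ h (heap + n + 3 * j + 1) ∨
    h (heap + n + 3 * j + 1) + h (heap + n + 3 * j) ≤ h (heap + n + 3 * i + 1)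
  sum : ∑ i ∈ Finset.range c, h (heap + n + 3 * i) = n
  inner : 2 * ((Finset.range c).filter fun i => h (heap + n + 3 * i) = 0).card + 1 = c

/-- The records represent a prefix of `T`, up to the fact that the leaf records from number `i` on
may still be large: each record stands for a subtree of `T`, a leaf record lists the vertices of the
subtree, and the record of an internal node points to the records of the two children. -/
def Consistent (T : ClusterTree n) (h : ℕ → ℕ) (i c : ℕ) : Prop :=
  ∃ f : ℕ → ClusterTree n, f 0 = T ∧ ∀ j < c, (f j).Sub T ∧
    (h (heap + n + 3 * j) ≠ 0 → Seg h (h (heap + n + 3 * j + 1))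
      (h (heap + n + 3 * j + 1) + h (heap + n + 3 * j)) (f j).verts) ∧
    (h (heap + n + 3 * j) = 0 → ∃ x y, j < x ∧ x < c ∧ j < y ∧ y < c ∧
      h (heap + n + 3 * j + 1) = heap + n + 3 * x ∧ h (heap + n + 3 * j + 2) = heap + n + 3 * y ∧
      (f j).Children (f x) (f y)) ∧
    (j < i → h (heap + n + 3 * j) ≤ threshold n)

theorem Layout.count_le {h : ℕ → ℕ} {c : ℕ} (hl : Layout n h c) : c + 1 ≤ 2 * n := by
  have h1 := Finset.card_filter_add_card_filter_not (s := Finset.range c)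
    (p := fun i => h (heap + n + 3 * i) = 0)
  have h2 : ((Finset.range c).filter fun i => ¬ h (heap + n + 3 * i) = 0).card ≤
      ∑ i ∈ Finset.range c, h (heap + n + 3 * i) := by
    rw [Finset.card_eq_sum_ones]
    refine (Finset.sum_le_sum fun i hi => ?_).trans
      (Finset.sum_le_sum_of_subset (Finset.filter_subset _ _))
    exact Nat.one_le_iff_ne_zero.2 (Finset.mem_filter.1 hi).2
  rw [hl.sum] at h2
  rw [Finset.card_range] at h1
  have h3 := hl.inner
  omega

theorem Layout.congr {h h' : ℕ → ℕ} {c : ℕ} (hl : Layout n h c)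
    (hh : ∀ a, heap + n ≤ a → h' a = h a) : Layout n h' c := by
  have e0 : ∀ i, h' (heap + n + 3 * i) = h (heap + n + 3 * i) := fun i => hh _ (by omega)
  have e1 : ∀ i, h' (heap + n + 3 * i + 1) = h (heap + n + 3 * i + 1) := fun i => hh _ (by omega)
  refine ⟨?_, ?_, ?_, ?_⟩
  · simpa only [e0, e1] using hl.bound
  · simpa only [e0, e1] using hl.disjoint
  · simpa only [e0] using hl.sum
  · simpa only [e0] using hl.inner

/-- `Split n h h' i c lo p hi`: the leaf record `i` with the segment `[lo, hi)` has been replaced by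
the record of an internal node, whose children are two new leaf records with the segments `[lo, p)`
and `[p, hi)`. -/
structure Split (n : ℕ) (h h' : ℕ → ℕ) (i c lo p hi : ℕ) : Prop where
  lt_count : i < c
  size : h (heap + n + 3 * i) = hi - lo
  addr : h (heap + n + 3 * i + 1) = lo
  lt_mid : lo < p
  mid_lt : p < hi
  root : h' (heap + n + 3 * i) = 0
  left : h' (heap + n + 3 * i + 1) = heap + n + 3 * c
  right : h' (heap + n + 3 * i + 2) = heap + n + 3 * (c + 1)
  left_size : h' (heap + n + 3 * c) = p - lo
  left_addr : h' (heap + n + 3 * c + 1) = lo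
  right_size : h' (heap + n + 3 * (c + 1)) = hi - p
  right_addr : h' (heap + n + 3 * (c + 1) + 1) = p
  eq_of_ne : ∀ j < c, j ≠ i → ∀ e < 3, h' (heap + n + 3 * j + e) = h (heap + n + 3 * j + e)
  eq_of_notMem : ∀ a, heap ≤ a → a < heap + n → a ∉ Set.Ico lo hi → h' a = h a

theorem Split.layout {h h' : ℕ → ℕ} {i c lo p hi : ℕ} (hs : Split n h h' i c lo p hi)
    (hl : Layout n h c) : Layout n h' (c + 2) := by
  obtain ⟨hic, hsz, had, hlp, hph, hr0, hr1, hr2, hls, hla, hrs, hra, hne, -⟩ := hs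
  have hb := hl.bound i hic (by omega)
  rw [hsz, had] at hb
  have e0 : ∀ j < c, j ≠ i → h' (heap + n + 3 * j) = h (heap + n + 3 * j) := fun j hj hji =>
    hne j hj hji 0 (by omega)
  have e1 : ∀ j < c, j ≠ i → h' (heap + n + 3 * j + 1) = h (heap + n + 3 * j + 1) :=
    fun j hj hji => hne j hj hji 1 (by omega)
  have hdi : ∀ j < c, j ≠ i → h (heap + n + 3 * j) ≠ 0 →
      hi ≤ h (heap + n + 3 * j + 1) ∨
      h (heap + n + 3 * j + 1) + h (heap + n + 3 * j) ≤ lo := fun j hj hji hj0 => by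
    have := hl.disjoint i hic j hj hji.symm (by omega) hj0
    rw [hsz, had] at this
    omega
  have hcase : ∀ j < c + 2, h' (heap + n + 3 * j) ≠ 0 →
      (j = c ∧ h' (heap + n + 3 * j) = p - lo ∧ h' (heap + n + 3 * j + 1) = lo) ∨
      (j = c + 1 ∧ h' (heap + n + 3 * j) = hi - p ∧ h' (heap + n + 3 * j + 1) = p) ∨
      (j < c ∧ h' (heap + n + 3 * j) = h (heap + n + 3 * j) ∧
        h' (heap + n + 3 * j + 1) = h (heap + n + 3 * j + 1) ∧ h (heap + n + 3 * j) ≠ 0 ∧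
        (hi ≤ h (heap + n + 3 * j + 1) ∨
          h (heap + n + 3 * j + 1) + h (heap + n + 3 * j) ≤ lo)) := by
    intro j hj hj0
    have hji : j ≠ i := by
      rintro rfl
      exact hj0 hr0
    rcases eq_or_ne j c with hjc | hjc
    · rw [hjc]
      exact Or.inl ⟨rfl, hls, hla⟩
    rcases eq_or_ne j (c + 1) with hjc' | hjc'
    · rw [hjc']
      exact Or.inr (Or.inl ⟨rfl, hrs, hra⟩)
    have hjlt : j < c := by omega
    rw [e0 j hjlt hji] at hj0 ⊢
    exact Or.inr (Or.inr ⟨hjlt, rfl, e1 j hjlt hji, hj0, hdi j hjlt hji hj0⟩)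
  refine ⟨?_, ?_, ?_, ?_⟩
  · intro j hj hj0
    rcases hcase j hj hj0 with ⟨-, a1, a2⟩ | ⟨-, a1, a2⟩ | ⟨hjlt, a1, a2, a3, -⟩
    · omega
    · omega
    · rw [a1, a2]
      exact hl.bound j hjlt a3
  · intro j hj k hk hjk hj0 hk0
    rcases hcase j hj hj0 with ⟨_, a1, a2⟩ | ⟨_, a1, a2⟩ | ⟨hjlt, a1, a2, a3, a4⟩ <;>
    rcases hcase k hk hk0 with ⟨_, b1, b2⟩ | ⟨_, b1, b2⟩ | ⟨hklt, b1, b2, b3, b4⟩ <;>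
    rw [a1, a2, b1, b2]
    all_goals first
      | omega
      | exact hl.disjoint j hjlt k hklt hjk a3 b3
  · have hmem : i ∈ Finset.range c := Finset.mem_range.2 hic
    have h1 : ∑ j ∈ (Finset.range c).erase i, h' (heap + n + 3 * j) =
        ∑ j ∈ (Finset.range c).erase i, h (heap + n + 3 * j) :=
      Finset.sum_congr rfl fun j hj => by
        rw [Finset.mem_erase, Finset.mem_range] at hj
        exact e0 j hj.2 hj.1
    have h2 := hl.sum
    rw [← Finset.add_sum_erase _ _ hmem, hsz] at h2
    rw [Finset.sum_range_succ, Finset.sum_range_succ, ← Finset.add_sum_erase _ _ hmem, hr0, hls,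
      hrs, h1]
    omega
  · have h1 : (Finset.range (c + 2)).filter (fun j => h' (heap + n + 3 * j) = 0) =
        insert i ((Finset.range c).filter fun j => h (heap + n + 3 * j) = 0) := by
      ext j
      simp only [Finset.mem_filter, Finset.mem_range, Finset.mem_insert]
      by_cases hji : j = i
      · subst hji
        simp [hr0]
        omega
      simp only [hji, false_or]
      constructor
      · rintro ⟨h1, h2⟩
        obtain rfl | rfl | h3 : j = c ∨ j = c + 1 ∨ j < c := by omega
        · omega
        · omega
        · exact ⟨h3, (e0 j h3 hji).symm.trans h2⟩
      · rintro ⟨h1, h2⟩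
        exact ⟨by omega, (e0 j h1 hji).trans h2⟩
    rw [h1, Finset.card_insert_of_notMem (by simp [hsz]; omega)]
    have := hl.inner
    omega

theorem Seg.congr {h h' : ℕ → ℕ} {lo hi : ℕ} {S : Finset (Fin n)} (hs : Seg h lo hi S)
    (hh : ∀ a ∈ Set.Ico lo hi, h' a = h a) : Seg h' lo hi S := by
  refine ⟨hs.1.congr fun a ha => (hh a ha).symm, ?_⟩
  rw [← hs.2]
  refine Finset.image_congr fun a ha => hh a (by simpa using ha)

theorem Split.consistent {T a b : ClusterTree n} {f : ℕ → ClusterTree n} {h h' : ℕ → ℕ}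
    {i c lo p hi : ℕ} (hs : Split n h h' i c lo p hi) (hl : Layout n h c) (hf0 : f 0 = T)
    (hf : ∀ j < c, (f j).Sub T ∧
      (h (heap + n + 3 * j) ≠ 0 → Seg h (h (heap + n + 3 * j + 1))
        (h (heap + n + 3 * j + 1) + h (heap + n + 3 * j)) (f j).verts) ∧
      (h (heap + n + 3 * j) = 0 → ∃ x y, j < x ∧ x < c ∧ j < y ∧ y < c ∧
        h (heap + n + 3 * j + 1) = heap + n + 3 * x ∧ h (heap + n + 3 * j + 2) = heap + n + 3 * y ∧
        (f j).Children (f x) (f y)) ∧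
      (j < i → h (heap + n + 3 * j) ≤ threshold n))
    (hc : (f i).Children a b) (ha : Seg h' lo p a.verts) (hb : Seg h' p hi b.verts) :
    Consistent T h' (i + 1) (c + 2) := by
  have hlay := hs.layout hl
  have hdis : ∀ j < c, j ≠ i → h (heap + n + 3 * j) ≠ 0 →
      hi ≤ h (heap + n + 3 * j + 1) ∨
      h (heap + n + 3 * j + 1) + h (heap + n + 3 * j) ≤ lo := fun j hj hji hj0 => by
    have h1 := hs.lt_mid
    have h2 := hs.mid_lt
    have := hl.disjoint i hs.lt_count j hj hji.symm (by rw [hs.size]; omega) hj0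
    rw [hs.size, hs.addr] at this
    omega
  have hic := hs.lt_count
  refine ⟨fun j => if j = c then a else if j = c + 1 then b else f j, ?_, fun j hj => ?_⟩
  · simp only
    rw [if_neg (by omega), if_neg (by omega), hf0]
  have hfi := (hf i hic).1
  obtain hj' | hj' | hj' | ⟨h1, h2⟩ : j = i ∨ j = c ∨ j = c + 1 ∨ (j < c ∧ j ≠ i) := by omega
  · subst hj'
    simp only [if_neg (show j ≠ c by omega), if_neg (show j ≠ c + 1 by omega)]
    refine ⟨hfi, fun h0 => absurd hs.root h0, fun _ => ⟨c, c + 1, by omega, by omega, by omega,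
      by omega, hs.left, hs.right, ?_⟩, fun _ => by rw [hs.root]; omega⟩
    simpa using hc
  · rw [hj']
    simp only [if_true, hs.left_size, hs.left_addr]
    have := hs.lt_mid
    refine ⟨hc.sub_fst.trans hfi, fun _ => ?_, fun h0 => by omega, fun h0 => by omega⟩
    rwa [show lo + (p - lo) = p by omega]
  · rw [hj']
    simp only [if_neg (show c + 1 ≠ c by omega), if_true, hs.right_size, hs.right_addr]
    have := hs.mid_lt
    refine ⟨hc.symm.sub_fst.trans hfi, fun _ => ?_, fun h0 => by omega, fun h0 => by omega⟩
    rwa [show p + (hi - p) = hi by omega]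
  · simp only [if_neg (show j ≠ c by omega), if_neg (show j ≠ c + 1 by omega)]
    obtain ⟨f1, f2, f3, f4⟩ := hf j h1
    have e0 : h' (heap + n + 3 * j) = h (heap + n + 3 * j) := hs.eq_of_ne j h1 h2 0 (by omega)
    rw [e0, hs.eq_of_ne j h1 h2 1 (by omega), hs.eq_of_ne j h1 h2 2 (by omega)]
    refine ⟨f1, fun h0 => (f2 h0).congr fun x hx => ?_, fun h0 => ?_,
      fun h0 => f4 (Nat.lt_of_le_of_ne (Nat.lt_succ_iff.1 h0) h2)⟩
    · have hb := hl.bound j h1 h0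
      have := hdis j h1 h2 h0
      rw [Set.mem_Ico] at hx
      exact hs.eq_of_notMem x (by omega) (by omega) (by rw [Set.mem_Ico]; omega)
    · obtain ⟨x, y, g1, g2, g3, g4, g5, g6, g7⟩ := f3 h0
      refine ⟨x, y, g1, by omega, g3, by omega, g5, g6, ?_⟩
      simpa only [if_neg (show x ≠ c by omega), if_neg (show x ≠ c + 1 by omega),
        if_neg (show y ≠ c by omega), if_neg (show y ≠ c + 1 by omega)] using g7

theorem Consistent.congr {T : ClusterTree n} {h h' : ℕ → ℕ} {i c : ℕ} (hc : Consistent T h i c)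
    (hl : Layout n h c) (hh : ∀ a, heap ≤ a → h' a = h a) : Consistent T h' i c := by
  obtain ⟨f, hf0, hf⟩ := hc
  refine ⟨f, hf0, fun j hj => ?_⟩
  rw [hh _ (by omega), hh (heap + n + 3 * j + 1) (by omega), hh (heap + n + 3 * j + 2) (by omega)]
  obtain ⟨f1, f2, f3⟩ := hf j hj
  refine ⟨f1, fun h0 => (f2 h0).congr fun x hx => hh x ?_, f3⟩
  have := hl.bound j hj h0
  rw [Set.mem_Ico] at hx
  omega

theorem Consistent.succ {T : ClusterTree n} {h : ℕ → ℕ} {i c : ℕ} (hc : Consistent T h i c)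
    (hi : h (heap + n + 3 * i) ≤ threshold n) : Consistent T h (i + 1) c := by
  obtain ⟨f, hf0, hf⟩ := hc
  refine ⟨f, hf0, fun j hj => ?_⟩
  obtain ⟨f1, f2, f3, f4⟩ := hf j hj
  refine ⟨f1, f2, f3, fun hji => ?_⟩
  rcases Nat.lt_succ_iff_lt_or_eq.1 hji with h1 | rfl
  · exact f4 h1
  · exact hi

theorem Seg.exists_list {h : ℕ → ℕ} {lo k : ℕ} {S : Finset (Fin n)} (hs : Seg h lo (lo + k) S) :
    ∃ L : List (Fin n), L.Nodup ∧ L.toFinset = S ∧ L.length = k ∧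
      ∀ i (hi : i < L.length), h (lo + i) = (L[i] : ℕ) := by
  have hex : ∀ i : Fin k, ∃ v ∈ S, h (lo + i) = (v : ℕ) := fun i =>
    hs.exists_mem (Set.mem_Ico.2 ⟨by omega, by omega⟩)
  choose g hgS hg using hex
  refine ⟨List.ofFn g, ?_, ?_, List.length_ofFn, fun i hi => ?_⟩
  · refine List.nodup_ofFn.2 fun i j hij => ?_
    have := hs.1 (Set.mem_Ico.2 ⟨by omega, by omega⟩) (Set.mem_Ico.2 ⟨by omega, by omega⟩)
      ((hg i).trans ((congrArg Fin.val hij).trans (hg j).symm))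
    exact Fin.ext (by omega)
  · ext v
    rw [List.mem_toFinset, List.mem_ofFn]
    constructor
    · rintro ⟨i, rfl⟩
      exact hgS i
    · intro hv
      obtain ⟨x, hx, hxv⟩ := hs.exists_index hv
      rw [Set.mem_Ico] at hx
      refine ⟨⟨x - lo, by omega⟩, Fin.ext ?_⟩
      rw [← hg, ← hxv]
      congr 1
      simp only
      omega
  · rw [List.length_ofFn] at hi
    rw [List.getElem_ofFn]
    exact hg ⟨i, hi⟩

/-- When all records have been processed, the memory stores a prefix of `T` with small leaves. -/
theorem Consistent.exists_stores {T : ClusterTree n} {h : ℕ → ℕ} {c A : ℕ}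
    (hc : Consistent T h c c) (hl : Layout n h c) (hA : heap + n + 3 * c ≤ A) (h0 : 0 < c) :
    ∃ I, Stores h A (heap + n) I ∧ ClusterTree.Prefix I T ∧
      ∀ X, I.HasLeaf X → X.card ≤ threshold n := by
  obtain ⟨f, hf0, hf⟩ := hc
  suffices ∀ d j, j + d + 1 = c → ∃ I, Stores h A (heap + n + 3 * j) I ∧
      ClusterTree.Prefix I (f j) ∧ ∀ X, I.HasLeaf X → X.card ≤ threshold n by
    have := this (c - 1) 0 (by omega)
    rwa [hf0] at this
  intro d
  induction d using Nat.strong_induction_on with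
  | _ d ih =>
    intro j hj
    obtain ⟨-, f2, f3, f4⟩ := hf j (by omega)
    have f4 := f4 (by omega)
    by_cases hj0 : h (heap + n + 3 * j) = 0
    · obtain ⟨x, y, g1, g2, g3, g4, g5, g6, g7⟩ := f3 hj0
      obtain ⟨I, hI1, hI2, hI3⟩ := ih (c - 1 - x) (by omega) x (by omega)
      obtain ⟨J, hJ1, hJ2, hJ3⟩ := ih (c - 1 - y) (by omega) y (by omega)
      exact ⟨.node I J, .node _ _ _ (by omega) hj0 (by rwa [g5]) (by rwa [g6]), .node g7 hI2 hJ2,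
        fun X hX => hX.elim (hI3 X) (hJ3 X)⟩
    · have hs := f2 hj0
      have hb := hl.bound j (by omega) hj0
      obtain ⟨L, hL1, hL2, hL3, hL4⟩ := hs.exists_list
      refine ⟨.leaf L.toFinset, .leaf _ L ?_ hL1 (by omega) hL3.symm (by omega) hL4, ?_, ?_⟩
      · rintro rfl
        exact hj0 hL3.symm
      · rw [hL2]
        exact .leaf _
      · intro X hX
        simp only [ClusterTree.HasLeaf] at hX
        rw [hX, List.toFinset_card_of_nodup hL1, hL3]
        exact f4

end Layout

/-! ### The main loop -/

/-- Turn the record at `rCur` into the record of an internal node, whose children have the records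
at `rTop` and `rTop + 3`; the latter address is kept in `rT`. -/
def rootCmd : Cmd :=
  block [
    .const rT 0, .store rCur rT,
    .arith .add rX rCur rOne, .store rX rTop,
    .arith .add rX rX rOne, .const rT 3, .arith .add rT rTop rT, .store rX rT]

/-- Write a leaf record for the segment between the addresses in `a` and `b` to the address in
`r`. -/
def leafCmd (a b r : ℕ) : Cmd :=
  block [.arith .sub rCnt b a, .store r rCnt, .arith .add rX r rOne, .store rX a]

/-- Replace the leaf record at `rCur` with the segment `[rLo, rHi)` by an internal node, whose
children are two new leaf records at `rTop` with the segments `[rLo, rP)` and `[rP, rHi)`. -/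
def branchCmd : Cmd :=
  block [rootCmd, leafCmd rLo rP rTop, leafCmd rP rHi rT, .const rX 3, .arith .add rTop rT rX]

/-- Split the cluster of the leaf record at `rCur`: the tournament, the partition, and, if both
parts are nonempty, the new records. The second part may be empty if the oracle is not reliable;
then the record remains a leaf. -/
def splitCmd : Cmd :=
  block [
    .arith .add rX rCur rOne, .load rLo rX, .arith .add rHi rLo rSize,
    .arith .mul rP rLo rOne, .const rMul 2, .const rInc 0, scanCmd false,
    .arith .add rP rLo rOne, .const rMul 6, .const rInc 1, scanCmd true,
    .ite rP rHi branchCmd .skip]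

/-- Process the records one after the other. -/
def mainLoop : Cmd :=
  .loop rCur rTop <| block [
    .load rSize rCur,
    .ite rK rSize splitCmd .skip,
    .const rT 3,
    .arith .add rCur rCur rT]

section

variable {n : ℕ} {w A : ℕ} {O : Oracle n} {Q : (ℕ → ℕ) → ℕ → ℕ → Prop} {m : ℕ → ℕ} {t q : ℕ}

theorem pre_rootCmd {cur top : ℕ} (hcur : heap ≤ cur) (htop : cur + 3 ≤ top)
    (hA : top + 6 ≤ A) (hw : 6 * A < 2 ^ w) (h1 : m rOne = 1) (hC : m rCur = cur)
    (hT : m rTop = top)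
    (hQ : ∀ m' t', (∀ a, a < rT ∨ a = rCur ∨ a = rTop → m' a = m a) → m' rT = top + 3 →
      m' cur = 0 → m' (cur + 1) = top → m' (cur + 2) = top + 3 →
      (∀ a, heap ≤ a → ¬ (cur ≤ a ∧ a < cur + 3) → m' a = m a) →
      t' ≤ t + 16 → Q m' t' q) : pre w A O rootCmd Q m t q := by
  simp only [rootCmd, block, pre, Arith.eval]
  simp (disch := omega) only [Function.update_self, Function.update_of_ne, h1, hC, hT,
    add_assoc, Nat.reduceAdd]
  refine ⟨by omega, by positivity, by omega, by omega, by omega, by omega, by omega, by omega,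
    by omega, by omega, by omega, by omega, by omega, by omega, by omega, by omega, by omega,
    by omega, by omega, by omega, by omega, by omega, by omega, by omega, by omega,
    hQ _ _ (fun a ha => ?_) ?_ ?_ ?_ ?_ (fun a ha1 ha2 => ?_) (by omega)⟩
  all_goals simp (disch := omega) only [Function.update_self, Function.update_of_ne]

theorem pre_leafCmd {a b r x lo hi : ℕ} (ha : a < rCnt) (hb : b < rCnt) (hr : rCnt < r)
    (hr' : r < rX) (hx : heap ≤ x) (hA : x + 1 < A) (hw : 6 * A < 2 ^ w) (h1 : m rOne = 1)
    (hR : m r = x) (hL : m a = lo) (hH : m b = hi) (hhi : hi ≤ A)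
    (hQ : ∀ m' t', (∀ a, a < rCnt ∨ rT ≤ a ∧ a < rX → m' a = m a) →
      m' x = hi - lo → m' (x + 1) = lo →
      (∀ a, heap ≤ a → a ≠ x → a ≠ x + 1 → m' a = m a) → t' ≤ t + 7 → Q m' t' q) :
    pre w A O (leafCmd a b r) Q m t q := by
  simp only [leafCmd, block, pre, Arith.eval]
  simp (disch := omega) only [Function.update_self, Function.update_of_ne, h1, hR, hL, hH]
  refine ⟨by omega, by omega, by omega, by omega, by omega, by omega, by omega, by omega,
    by omega, by omega, by omega, by omega, by omega, by omega,
    hQ _ _ (fun a ha => ?_) ?_ ?_ (fun a ha1 ha2 ha3 => ?_) (by omega)⟩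
  all_goals simp (disch := omega) only [Function.update_self, Function.update_of_ne]

theorem pre_branchCmd {cur top lo p hi : ℕ} (hcur : heap ≤ cur) (htop : cur + 3 ≤ top)
    (hA : top + 6 ≤ A) (hw : 6 * A < 2 ^ w) (h1 : m rOne = 1) (hC : m rCur = cur)
    (hT : m rTop = top) (hL : m rLo = lo) (hP : m rP = p) (hH : m rHi = hi) (hhi : hi ≤ A)
    (hp : p ≤ A)
    (hQ : ∀ m' t', (∀ a, a < rSize ∨ a = rCur → m' a = m a) → m' rTop = top + 6 →
      m' cur = 0 → m' (cur + 1) = top → m' (cur + 2) = top + 3 → m' top = p - lo →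
      m' (top + 1) = lo → m' (top + 3) = hi - p → m' (top + 4) = p →
      (∀ a, heap ≤ a → a < top → ¬ (cur ≤ a ∧ a < cur + 3) → m' a = m a) →
      t' ≤ t + 40 → Q m' t' q) : pre w A O branchCmd Q m t q := by
  simp only [branchCmd, block, pre, Arith.eval]
  refine pre_rootCmd hcur htop hA hw h1 hC hT ?_
  intro m₃ t₃ a1 a2 a3 a4 a5 a6 a7
  refine pre_leafCmd (x := top) (lo := lo) (hi := p) (by omega) (by omega) (by omega)
    (by omega) (by omega) (by omega) hw (by rw [a1 _ (by omega), h1])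
    (by rw [a1 _ (by omega), hT]) (by rw [a1 _ (by omega), hL])
    (by rw [a1 _ (by omega), hP]) hp ?_
  intro m₄ t₄ b1 b2 b3 b4 b5
  refine pre_leafCmd (x := top + 3) (lo := p) (hi := hi) (by omega) (by omega)
    (by omega) (by omega) (by omega) (by omega) hw (by rw [b1 _ (by omega), a1 _ (by omega), h1])
    (by rw [b1 _ (by omega), a2]) (by rw [b1 _ (by omega), a1 _ (by omega), hP])
    (by rw [b1 _ (by omega), a1 _ (by omega), hH]) hhi ?_
  intro m₅ t₅ d1 d2 d3 d4 d5
  have l5 : m₅ rT = top + 3 := by rw [d1 _ (by omega), b1 _ (by omega), a2]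
  simp (disch := omega) only [Function.update_self, Function.update_of_ne, l5]
  have hh : ∀ a, heap ≤ a → Function.update (Function.update m₅ rX 3) rTop (top + 3 + 3) a =
      m₅ a := by
    intro a ha
    rw [Function.update_of_ne (by omega), Function.update_of_ne (by omega)]
  refine ⟨by omega, by omega, by omega, by omega, by omega, by omega,
    hQ _ _ (fun a ha => ?_) ?_ ?_ ?_ ?_ ?_ ?_ ?_ ?_ (fun a ha1 ha2 ha3 => ?_) (by omega)⟩
  · rw [Function.update_of_ne (by omega), Function.update_of_ne (by omega), d1 a (by omega),
      b1 a (by omega), a1 a (by omega)]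
  · rw [Function.update_self]
  · rw [hh _ (by omega), d4 _ (by omega) (by omega) (by omega),
      b4 _ (by omega) (by omega) (by omega), a3]
  · rw [hh _ (by omega), d4 _ (by omega) (by omega) (by omega),
      b4 _ (by omega) (by omega) (by omega), a4]
  · rw [hh _ (by omega), d4 _ (by omega) (by omega) (by omega),
      b4 _ (by omega) (by omega) (by omega), a5]
  · rw [hh _ (by omega), d4 _ (by omega) (by omega) (by omega), b2]
  · rw [hh _ (by omega), d4 _ (by omega) (by omega) (by omega), b3]
  · rw [hh _ (by omega), d2]
  · exact (hh _ (by omega)).trans d3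
  · rw [hh a ha1, d4 a ha1 (by omega) (by omega), b4 a ha1 (by omega) (by omega), a6 a ha1 ha3]

theorem pre_splitCmd {i c : ℕ} (hn : 2 ≤ n) (hA : A = 8 * n + 33) (hw : 6 * A < 2 ^ w)
    (h1 : m rOne = 1) (hC : m rCur = heap + n + 3 * i) (hT : m rTop = heap + n + 3 * c)
    (hS : m rSize = m (heap + n + 3 * i)) (hlarge : threshold n < m (heap + n + 3 * i))
    (hic : i < c) (hl : Layout n m c)
    (hQ : ∀ m' t' q' c', (∀ a, a < rSize ∨ a = rCur → m' a = m a) →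
      m' rTop = heap + n + 3 * c' → c ≤ c' → Layout n m' c' →
      (∀ T bad, T.IsHCTree → Reliable O T bad → Consistent T m i c → Consistent T m' (i + 1) c') →
      t' ≤ t + 2 * (n * (12 * n + 40)) + 80 → q' ≤ q + 2 * (n * n) → Q m' t' q') :
    pre w A O splitCmd Q m t q := by
  obtain ⟨hlo, hhi⟩ := hl.bound i hic (by omega)
  have hcn := hl.count_le
  obtain ⟨N, hN⟩ : ∃ N, N = m (heap + n + 3 * i) := ⟨_, rfl⟩
  obtain ⟨lo, hlo'⟩ : ∃ lo, lo = m (heap + n + 3 * i + 1) := ⟨_, rfl⟩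
  obtain ⟨hi, hhi'⟩ : ∃ hi, hi = lo + N := ⟨_, rfl⟩
  have hNhi : hi - lo = N := by omega
  rw [← hN] at hlarge hS hhi
  rw [← hlo'] at hlo hhi
  rw [← hhi'] at hhi
  have hlt : lo < hi := by omega
  simp only [splitCmd, block, pre, Arith.eval]
  simp (disch := omega) only [Function.update_self, Function.update_of_ne, h1, hC, hS, ← hlo',
    ← hhi', mul_one]
  refine ⟨by omega, by omega, by omega, by omega, by omega, by omega, by omega, by omega, by omega,
    by omega, by omega, by omega, by omega, by omega, by omega, by omega, by omega, by omega,
    by positivity, ?_⟩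
  refine pre_scanCmd false (lo := lo) (hi := hi) (p := lo) (mul := 2) (inc := 0) (h := m) hlo hlt
    (by omega) hw le_rfl (by omega) (by omega) (by omega)
    (by simp (disch := omega) only [Function.update_of_ne, h1])
    (by simp (disch := omega) only [Function.update_of_ne, hS, hNhi])
    (by simp (disch := omega) only [Function.update_self, Function.update_of_ne])
    (by simp (disch := omega) only [Function.update_self, Function.update_of_ne])
    (by simp (disch := omega) only [Function.update_self, Function.update_of_ne])
    (by simp (disch := omega) only [Function.update_self, Function.update_of_ne])
    (by simp only [Function.update_self])
    (fun a ha => by simp (disch := omega) only [Function.update_of_ne]) ?_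
  intro m₁ t₁ q₁ hf₁ _ hh₁ ht₁ hq₁
  obtain ⟨h₁, hh₁'⟩ : ∃ h₁, h₁ = (scan O false 2 0 lo hi m lo (hi - lo - 1)).1 := ⟨_, rfl⟩
  rw [← hh₁'] at hh₁
  have hf₁' : ∀ a, a < rLo ∨ a = rCur ∨ a = rTop → m₁ a = m a := by
    intro a ha
    rw [hf₁ a (by omega)]
    simp (disch := omega) only [Function.update_of_ne]
  have g4 : m₁ rLo = lo := by
    rw [hf₁ _ (by omega)]
    simp (disch := omega) only [Function.update_self, Function.update_of_ne]
  have g5 : m₁ rHi = hi := by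
    rw [hf₁ _ (by omega)]
    simp (disch := omega) only [Function.update_self, Function.update_of_ne]
  have g1 : m₁ rOne = 1 := by rw [hf₁' _ (by omega), h1]
  clear hf₁
  rw [g1, g4]
  refine ⟨by omega, by omega, by omega, by omega, by omega, by omega, by omega, by omega, ?_⟩
  refine pre_scanCmd true (lo := lo) (hi := hi) (p := lo + 1) (mul := 6) (inc := 1) (h := h₁) hlo
    hlt
    (by omega) hw (by omega) le_rfl (by omega) (by omega)
    (by simp (disch := omega) only [Function.update_of_ne, g1])
    (by simp (disch := omega) only [Function.update_of_ne, hf₁', hS, hNhi])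
    (by simp (disch := omega) only [Function.update_of_ne, g4])
    (by simp (disch := omega) only [Function.update_of_ne, g5])
    (by simp (disch := omega) only [Function.update_self, Function.update_of_ne])
    (by simp (disch := omega) only [Function.update_self, Function.update_of_ne])
    (by simp only [Function.update_self])
    (fun a ha => by
      simp (disch := omega) only [Function.update_of_ne]
      exact hh₁ a ha) ?_
  intro m₂ t₂ q₂ hf₂ hp₂ hh₂ ht₂ hq₂
  obtain ⟨⟨h₂, p⟩, hhp⟩ : ∃ hp : (ℕ → ℕ) × ℕ,
    hp = scan O true 6 1 lo hi h₁ (lo + 1) (hi - lo - 1) := ⟨_, rfl⟩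
  have hpt := scan_pointer (O := O) (own := true) (mul := 6) (hi := hi) (h := h₁)
    (p := lo + 1) le_rfl le_rfl (hi - lo - 1)
  rw [← hhp] at hp₂ hh₂ hpt
  simp only at hp₂ hh₂ hpt
  have hf₂' : ∀ a, a < rLo ∨ a = rCur ∨ a = rTop → m₂ a = m a := by
    intro a ha
    rw [hf₂ a (by omega)]
    simp (disch := omega) only [Function.update_of_ne]
    exact hf₁' a ha
  have k4 : m₂ rLo = lo := by
    rw [hf₂ _ (by omega)]
    simp (disch := omega) only [Function.update_of_ne, g4]
  have k5 : m₂ rHi = hi := by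
    rw [hf₂ _ (by omega)]
    simp (disch := omega) only [Function.update_of_ne, g5]
  have k1 : m₂ rOne = 1 := by rw [hf₂' _ (by omega), h1]
  clear hf₂ hf₁' hh₁
  -- The scans change the segment only.
  have hm₂ : ∀ a, heap ≤ a → a ∉ Set.Ico lo hi → m₂ a = m a := by
    intro a ha ha'
    have e1 := scan_apply_of_notMem (O := O) (own := true) (mul := 6) (hi := hi) (h := h₁)
      (p := lo + 1) (by omega) le_rfl le_rfl (d := hi - lo - 1) (by omega) ha'
    have e2 := scan_apply_of_notMem (O := O) (own := false) (mul := 2) (hi := hi) (h := m)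
      (p := lo) (inc := 0) le_rfl (by omega) (by omega) (d := hi - lo - 1) (by omega) ha'
    rw [← hhp] at e1
    rw [← hh₁'] at e2
    rw [hh₂ a ha, ← e2, ← e1]
  have hsplit : ∀ T bad, T.IsHCTree → Reliable O T bad → ∀ s : ClusterTree n, s.Sub T →
      Seg m lo hi s.verts →
      ∃ a b, ClusterTree.Children s a b ∧ Seg m₂ lo p a.verts ∧ Seg m₂ p hi b.verts := by
    intro T bad hT hR s hs hseg
    obtain ⟨a, b, hc, ha, hb⟩ := hR.split hT hn hs hseg (by omega) (Prod.ext hh₁'.symm rfl) hhp.symm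
    exact ⟨a, b, hc, ha.congr fun x hx => hh₂ x (by rw [Set.mem_Ico] at hx; omega),
      hb.congr fun x hx => hh₂ x (by rw [Set.mem_Ico] at hx; omega)⟩
  have hNn : hi - lo ≤ n := by omega
  have ht₃ : (hi - lo) * (12 * (hi - lo) + 40) ≤ n * (12 * n + 40) :=
    Nat.mul_le_mul hNn (by omega)
  have hq₃ : (hi - lo) * (hi - lo) ≤ n * n := Nat.mul_le_mul hNn hNn
  rw [k5, hp₂]
  refine ⟨by omega, by omega, fun hphi => ?_, fun hphi => ?_⟩
  · refine pre_branchCmd (cur := heap + n + 3 * i) (top := heap + n + 3 * c) (lo := lo) (p := p)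
      (hi := hi) (by omega) (by omega) (by omega) hw k1 (by rw [hf₂' _ (by omega), hC])
      (by rw [hf₂' _ (by omega), hT]) k4 hp₂ k5 (by omega) (by omega) ?_
    intro m₆ t₆ a1 a2 a3 a4 a5 a6 a7 a8 a9 hold a10
    have hS : Split n m m₆ i c lo p hi :=
      { lt_count := hic
        size := by omega
        addr := hlo'.symm
        lt_mid := by omega
        mid_lt := hphi
        root := a3
        left := a4
        right := a5
        left_size := a6
        left_addr := a7
        right_size := a8
        right_addr := a9
        eq_of_ne := fun j hj hji e he => by
          rw [hold _ (by omega) (by omega) (by omega),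
            hm₂ _ (by omega) (by rw [Set.mem_Ico]; omega)]
        eq_of_notMem := fun a ha1 ha2 ha3 => by
          rw [hold a ha1 (by omega) (by omega), hm₂ a ha1 ha3] }
    refine hQ m₆ _ _ (c + 2) (fun a ha => ?_) ?_ (by omega) (hS.layout hl) ?_ (by omega) (by omega)
    · rw [a1 a ha, hf₂' a (by omega)]
    · rw [a2]
      ring
    · rintro T bad hT hR ⟨f, hf0, hf⟩
      have hfi := (hf i hic).2.1 (by omega)
      rw [← hlo', ← hN, ← hhi'] at hfi
      obtain ⟨a, b, hc, ha, hb⟩ := hsplit T bad hT hR (f i) (hf i hic).1 hfi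
      refine hS.consistent hl hf0 hf hc (ha.congr fun x hx => ?_) (hb.congr fun x hx => ?_)
      · rw [Set.mem_Ico] at hx
        exact hold x (by omega) (by omega) (by omega)
      · rw [Set.mem_Ico] at hx
        exact hold x (by omega) (by omega) (by omega)
  · refine hQ m₂ _ _ c (fun a ha => hf₂' a (by omega)) (by rw [hf₂' _ (by omega), hT]) le_rfl
      (hl.congr fun a ha => hm₂ a (by omega) (by rw [Set.mem_Ico]; omega)) ?_ (by omega) (by omega)
    -- A reliable oracle leaves neither side of the split empty.
    rintro T bad hT hR ⟨f, hf0, hf⟩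
    have hfi := (hf i hic).2.1 (by omega)
    rw [← hlo', ← hN, ← hhi'] at hfi
    obtain ⟨a, b, hc, ha, hb⟩ := hsplit T bad hT hR (f i) (hf i hic).1 hfi
    have h3 := hb.card_eq
    have h4 := (hc.symm.sub_fst.laminar ((hf i hic).1.laminar hT.1)).verts_nonempty.card_pos
    omega

theorem reaches_mainLoop (hn : 2 ≤ n) (hA : A = 8 * n + 33) (hw : 6 * A < 2 ^ w)
    (hN : m rN = n) (h1 : m rOne = 1) (hK : m rK = threshold n) (hC : m rCur = heap + n)
    (hT : m rTop = heap + n + 3) (hl : Layout n m 1)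
    (hQ : ∀ m' t' q' c, m' rN = n → m' rOne = 1 → 0 < c → Layout n m' c →
      (∀ T bad, T.IsHCTree → Reliable O T bad → Consistent T m 0 1 → Consistent T m' c c) →
      t' ≤ t + 2 * n * (2 * (n * (12 * n + 40)) + 120) → q' ≤ q + 2 * n * (2 * (n * n)) →
      Q m' t' q') :
    Reaches w A O mainLoop Q m t q := by
  refine Reaches.loop (μ := fun m' => 6 * n + (heap + n) - m' rCur)
    (Inv := fun m' t' q' => (m' rN = n ∧ m' rOne = 1 ∧ m' rK = threshold n) ∧ ∃ i c,
      m' rCur = heap + n + 3 * i ∧ m' rTop = heap + n + 3 * c ∧ i ≤ c ∧ 0 < c ∧ Layout n m' c ∧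
      (∀ T bad, T.IsHCTree → Reliable O T bad → Consistent T m 0 1 → Consistent T m' i c) ∧
      t' ≤ t + i * (2 * (n * (12 * n + 40)) + 120) ∧ q' ≤ q + i * (2 * (n * n)))
    (by omega) (by omega) ?_ ?_ ?_
  · rintro m₁ t₁ q₁ ⟨⟨e0, e1, eK⟩, i, c, hC₁, hT₁, hic, h0, hl₁, hcons, ht₁, hq₁⟩ hlt
    rw [hC₁, hT₁] at hlt
    have hic' : i < c := by omega
    have hcn := hl₁.count_le
    refine Reaches.of_pre ?_
    simp only [block, pre, Arith.eval]
    simp (disch := omega) only [Function.update_self, Function.update_of_ne, hC₁, eK]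
    have hheap : ∀ a, heap ≤ a → Function.update m₁ rSize (m₁ (heap + n + 3 * i)) a = m₁ a :=
      fun a ha => Function.update_of_ne (by omega) _ _
    have hl₂ := hl₁.congr (h' := Function.update m₁ rSize (m₁ (heap + n + 3 * i)))
      fun a ha => hheap a (by omega)
    have hcons₂ : ∀ T bad, T.IsHCTree → Reliable O T bad → Consistent T m 0 1 →
        Consistent T (Function.update m₁ rSize (m₁ (heap + n + 3 * i))) i c :=
      fun T bad hT hR hc => (hcons T bad hT hR hc).congr hl₁ hheap
    have hregs : ∀ a, a < rSize ∨ a = rCur ∨ a = rTop →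
        Function.update m₁ rSize (m₁ (heap + n + 3 * i)) a = m₁ a :=
      fun a ha => Function.update_of_ne (by omega) _ _
    refine ⟨by omega, by omega, by omega, by omega, by omega, fun hlarge => ?_, fun hsmall =>
      ⟨by omega, by omega, by omega, by omega, by omega, by omega, ⟨⟨?_, ?_, ?_⟩, i + 1, c,
        ?_, ?_, by omega, h0, hl₂.congr fun a ha => ?_, fun T bad hT hR hc => ?_, ?_, ?_⟩, ?_⟩⟩
    · refine pre_splitCmd (i := i) (c := c) hn hA hw (by rw [hregs _ (by omega), e1])
        (by rw [hregs _ (by omega), hC₁]) (by rw [hregs _ (by omega), hT₁])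
        (by rw [Function.update_self, hheap _ (by omega)]) (by rwa [hheap _ (by omega)]) hic' hl₂ ?_
      intro m₂ t₂ q₂ c' hr hT₂ hcc hl₃ hcons₃ ht₂ hq₂
      have hr' : ∀ a, a < rSize ∨ a = rCur → m₂ a = m₁ a := fun a ha => by
        rw [hr a ha, hregs a (by omega)]
      have hC₂ : m₂ rCur = heap + n + 3 * i := by rw [hr' _ (by omega), hC₁]
      have hcn' := hl₃.count_le
      rw [hC₂]
      refine ⟨by omega, by omega, by omega, by omega, by omega, by omega, ⟨⟨?_, ?_, ?_⟩, i + 1, c',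
        ?_, ?_, by omega, by omega, hl₃.congr fun a ha => ?_, fun T bad hT hR hc => ?_, ?_, ?_⟩, ?_⟩
      · rw [hr' _ (by omega), e0]
      · rw [hr' _ (by omega), e1]
      · rw [hr' _ (by omega), eK]
      · ring
      · exact hT₂
      · simp (disch := omega) only [Function.update_of_ne]
      · exact (hcons₃ T bad hT hR (hcons₂ T bad hT hR hc)).congr hl₃ fun a ha => by
          simp (disch := omega) only [Function.update_of_ne]
      · rw [Nat.succ_mul]
        omega
      · rw [Nat.succ_mul]
        omega
      · omega
    · exact e0
    · exact e1
    · exact trivial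
    · ring
    · exact hT₁
    · simp (disch := omega) only [Function.update_of_ne]
    · refine ((hcons₂ T bad hT hR hc).succ ?_).congr hl₂ fun a ha => by
        simp (disch := omega) only [Function.update_of_ne]
      rw [hheap _ (by omega)]
      omega
    · rw [Nat.succ_mul]
      omega
    · rw [Nat.succ_mul]
      omega
    · omega
  · rintro m₁ t₁ q₁ ⟨⟨e0, e1, eK⟩, i, c, hC₁, hT₁, hic, h0, hl₁, hcons, ht₁, hq₁⟩ hlt
    rw [hC₁, hT₁] at hlt
    obtain rfl : i = c := by omega
    have hcn := hl₁.count_le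
    have h2 : i ≤ 2 * n := by omega
    refine hQ m₁ _ _ i e0 e1 h0 hl₁ hcons ?_ (hq₁.trans ?_)
    · have := Nat.mul_le_mul_right (2 * (n * (12 * n + 40)) + 120) (show i + 1 ≤ 2 * n by omega)
      rw [Nat.succ_mul] at this
      omega
    · exact Nat.add_le_add_left (Nat.mul_le_mul_right _ h2) _
  · exact ⟨⟨hN, h1, hK⟩, 0, 1, hC, hT, by omega, by omega, hl, fun _ _ _ _ h => h, by omega,
      by omega⟩

end

/-! ### The complete program -/

/-- Add to `rK` the binary logarithm of `rX`, by repeated halving. -/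
def logCmd : Cmd :=
  .loop rOne rX <| block [.arith .div rX rX rInc, .arith .add rK rK rOne]

/-- Append the vertices from `rJ` on to the array that ends at `rTop`. -/
def fillCmd : Cmd :=
  .loop rJ rN <| block [.store rTop rJ, .arith .add rTop rTop rOne, .arith .add rJ rJ rOne]

/-- Compute the threshold, initialize the array and the record of the root, process the records,
and let the word at address `0` point to the record of the root. -/
def mainCmd : Cmd :=
  block [
    .const rOne 1, .arith .mul rX rN rOne, .const rK 0, .const rInc 2, logCmd,
    .const rT 30000, .arith .mul rK rK rT,
    .const rJ 0, .const rTop heap, fillCmd,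
    .arith .mul rCur rTop rOne, .store rTop rN,
    .arith .add rX rTop rOne, .const rT heap, .store rX rT,
    .const rT 3, .arith .add rTop rTop rT,
    mainLoop,
    .const rT heap, .arith .add rN rN rT]

/-- The program. It begins with an access to the last address that it may need, so that the number
of words in use is constant from then on. The registers, the array and the records take less than
`heap + n + 6 * n` words. -/
def clusterCmd : Cmd :=
  block [
    .const rOne 8, .arith .mul rOne rOne rN, .const rK heap, .arith .add rOne rOne rK,
    .store rOne rK,
    mainCmd]

section

variable {n : ℕ} {w A : ℕ} {O : Oracle n} {Q : (ℕ → ℕ) → ℕ → ℕ → Prop} {m : ℕ → ℕ} {t q : ℕ}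

theorem reaches_logCmd (hA : heap ≤ A) (hw : n + 2 < 2 ^ w) (h1 : m rOne = 1) (hI : m rInc = 2)
    (hX : m rX = n) (hK : m rK = 0)
    (hQ : ∀ m' t', (∀ a, a ≠ rX → a ≠ rK → m' a = m a) → m' rK = Nat.log 2 n →
      t' ≤ t + 5 * n + 1 → Q m' t' q) :
    Reaches w A O logCmd Q m t q := by
  refine Reaches.loop (μ := fun m' => m' rX)
    (Inv := fun m' t' q' => (∀ a, a ≠ rX → a ≠ rK → m' a = m a) ∧
      m' rK + Nat.log 2 (m' rX) = Nat.log 2 n ∧ m' rX ≤ n ∧ t' + 5 * m' rX ≤ t + 5 * n ∧ q' = q)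
    (by omega) (by omega) ?_ ?_ ?_
  · rintro m₁ t₁ q₁ ⟨hf, hlog, hle, ht, hq⟩ hlt
    have e1 : m₁ rOne = 1 := by rw [hf _ (by omega) (by omega), h1]
    have e2 : m₁ rInc = 2 := by rw [hf _ (by omega) (by omega), hI]
    rw [e1] at hlt
    have hdiv := Nat.log_of_one_lt_of_le (b := 2) (n := m₁ rX) (by omega) (by omega)
    have hlogn : Nat.log 2 n ≤ n := Nat.log_le_self 2 n
    refine Reaches.of_pre ?_
    simp only [block, pre, Arith.eval]
    simp (disch := omega) only [Function.update_self, Function.update_of_ne, e1, e2]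
    refine ⟨by omega, by omega, by omega, by omega, by omega, by omega, by omega, by omega,
      ⟨fun a ha1 ha2 => ?_, by omega, by omega, by omega, hq⟩, by omega⟩
    simp (disch := omega) only [Function.update_of_ne, hf]
  · rintro m₁ t₁ q₁ ⟨hf, hlog, hle, ht, rfl⟩ hlt
    have e1 : m₁ rOne = 1 := by rw [hf _ (by omega) (by omega), h1]
    rw [e1] at hlt
    rw [Nat.log_of_lt (by omega : m₁ rX < 2)] at hlog
    exact hQ m₁ _ hf (by omega) (by omega)
  · exact ⟨fun _ _ _ => rfl, by rw [hK, hX]; omega, hX.le, by omega, rfl⟩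

theorem reaches_fillCmd (hA : heap + n ≤ A) (hw : A < 2 ^ w) (h1 : m rOne = 1) (hN : m rN = n)
    (hJ : m rJ = 0) (hT : m rTop = heap)
    (hQ : ∀ m' t', (∀ a < heap, a ≠ rJ → a ≠ rTop → m' a = m a) → m' rTop = heap + n →
      (∀ i < n, m' (heap + i) = i) → t' ≤ t + 6 * n + 1 → Q m' t' q) :
    Reaches w A O fillCmd Q m t q := by
  refine Reaches.loop (μ := fun m' => n - m' rJ)
    (Inv := fun m' t' q' => (∀ a < heap, a ≠ rJ → a ≠ rTop → m' a = m a) ∧ m' rJ ≤ n ∧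
      m' rTop = heap + m' rJ ∧ (∀ i < m' rJ, m' (heap + i) = i) ∧ t' ≤ t + 6 * m' rJ ∧ q' = q)
    (by omega) (by omega) ?_ ?_ ?_
  · rintro m₁ t₁ q₁ ⟨hf, hle, hT₁, harr, ht, hq⟩ hlt
    have e1 : m₁ rOne = 1 := by rw [hf _ (by omega) (by omega) (by omega), h1]
    have e2 : m₁ rN = n := by rw [hf _ (by omega) (by omega) (by omega), hN]
    rw [e2] at hlt
    refine Reaches.of_pre ?_
    simp only [block, pre, Arith.eval]
    simp (disch := omega) only [Function.update_self, Function.update_of_ne, e1, hT₁]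
    refine ⟨by omega, by omega, by omega, by omega, by omega, by omega, by omega, by omega,
      by omega, by omega, by omega,
      ⟨fun a ha1 ha2 ha3 => ?_, by omega, by omega, fun i hi => ?_, by omega, hq⟩, by omega⟩
    · simp (disch := omega) only [Function.update_of_ne, hf]
    · rcases Nat.lt_succ_iff_lt_or_eq.1 hi with h | rfl
      · simp (disch := omega) only [Function.update_of_ne, harr]
      · simp (disch := omega) only [Function.update_self]
  · rintro m₁ t₁ q₁ ⟨hf, hle, hT₁, harr, ht, rfl⟩ hlt
    have e2 : m₁ rN = n := by rw [hf _ (by omega) (by omega) (by omega), hN]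
    have e3 : m₁ rJ = n := by omega
    rw [e3] at hT₁ harr ht
    exact hQ m₁ _ hf hT₁ harr (by omega)
  · exact ⟨fun _ _ _ _ => rfl, by omega, by omega, fun i hi => by omega, by omega, rfl⟩

theorem Layout.init (hn : 2 ≤ n) (h0 : m (heap + n) = n) (h1 : m (heap + n + 1) = heap) :
    Layout n m 1 := by
  refine ⟨fun i hi _ => ?_, fun i hi j hj hij => by omega, ?_, ?_⟩
  · obtain rfl : i = 0 := by omega
    simp only [mul_zero, add_zero]
    omega
  · rw [Finset.sum_range_one]
    exact h0
  · rw [Finset.range_one, Finset.filter_singleton,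
      if_neg (by simp only [mul_zero, add_zero]; omega)]
    rfl

theorem Consistent.init {T : ClusterTree n} (hT : T.IsHCTree) (hn : 2 ≤ n)
    (h0 : m (heap + n) = n) (h1 : m (heap + n + 1) = heap) (harr : ∀ i < n, m (heap + i) = i) :
    Consistent T m 0 1 := by
  refine ⟨fun _ => T, rfl, fun j hj => ?_⟩
  obtain rfl : j = 0 := by omega
  simp only [mul_zero, add_zero]
  rw [h0, h1]
  refine ⟨ClusterTree.Sub.refl T, fun _ => ⟨fun x hx y hy hxy => ?_, ?_⟩, fun h => by omega,
    fun h => by omega⟩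
  · rw [Set.mem_Ico] at hx hy
    have e1 := harr (x - heap) (by omega)
    have e2 := harr (y - heap) (by omega)
    rw [show heap + (x - heap) = x by omega] at e1
    rw [show heap + (y - heap) = y by omega] at e2
    omega
  · rw [hT.2.1]
    ext x
    simp only [Finset.mem_image, Finset.mem_Ico, Finset.mem_map, Finset.mem_univ, true_and]
    constructor
    · rintro ⟨y, hy, rfl⟩
      have e2 := harr (y - heap) (by omega)
      rw [show heap + (y - heap) = y by omega] at e2
      exact ⟨⟨m y, by omega⟩, rfl⟩
    · rintro ⟨y, rfl⟩
      exact ⟨heap + y, by omega, harr y y.2⟩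

theorem reaches_mainCmd (hn : 2 ≤ n) (hA : A = 8 * n + 33) (hw : 6 * A < 2 ^ w)
    (hw' : 30000 * n < 2 ^ w) (hN : m rN = n)
    (hQ : ∀ m' t' q' c, m' rN = heap + n → 0 < c → Layout n m' c →
      (∀ T bad, T.IsHCTree → Reliable O T bad → Consistent T m' c c) →
      t' ≤ t + 2 * n * (2 * (n * (12 * n + 40)) + 120) + 11 * n + 100 →
      q' ≤ q + 2 * n * (2 * (n * n)) → Q m' t' q') :
    Reaches w A O mainCmd Q m t q := by
  have hlog : Nat.log 2 n ≤ n := Nat.log_le_self 2 n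
  refine Reaches.of_pre ?_
  simp only [mainCmd, block, pre, Arith.eval]
  simp (disch := omega) only [Function.update_self, Function.update_of_ne, hN, mul_one]
  refine ⟨by omega, by omega, by omega, by omega, by omega, by omega, by omega, by omega, by omega,
    by omega, ?_⟩
  refine reaches_logCmd (by omega) (by omega)
    (by simp (disch := omega) only [Function.update_self, Function.update_of_ne])
    (by simp (disch := omega) only [Function.update_self])
    (by simp (disch := omega) only [Function.update_self, Function.update_of_ne])
    (by simp (disch := omega) only [Function.update_self, Function.update_of_ne]) ?_
  intro m₁ t₁ hf₁ hK₁ ht₁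
  have a0 : m₁ rN = n := by
    rw [hf₁ _ (by omega) (by omega)]
    simp (disch := omega) only [Function.update_of_ne, hN]
  have a1 : m₁ rOne = 1 := by
    rw [hf₁ _ (by omega) (by omega)]
    simp (disch := omega) only [Function.update_self, Function.update_of_ne]
  clear hf₁
  simp only [hK₁]
  refine ⟨by omega, by omega, by omega, by omega, by omega, by omega, by omega, by omega, by omega,
    by omega, ?_⟩
  refine reaches_fillCmd (by omega) (by omega)
    (by simp (disch := omega) only [Function.update_of_ne, a1])
    (by simp (disch := omega) only [Function.update_of_ne, a0])
    (by simp (disch := omega) only [Function.update_self, Function.update_of_ne])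
    (by simp (disch := omega) only [Function.update_self]) ?_
  intro m₂ t₂ hf₂ hT₂ harr₂ ht₂
  have b0 : m₂ rN = n := by
    rw [hf₂ _ (by omega) (by omega) (by omega)]
    simp (disch := omega) only [Function.update_of_ne, a0]
  have b1 : m₂ rOne = 1 := by
    rw [hf₂ _ (by omega) (by omega) (by omega)]
    simp (disch := omega) only [Function.update_of_ne, a1]
  have b2 : m₂ rK = threshold n := by
    rw [hf₂ _ (by omega) (by omega) (by omega), threshold, mul_comm]
    simp (disch := omega) only [Function.update_self, Function.update_of_ne]
  clear hf₂
  simp (disch := omega) only [Function.update_of_ne, b0, b1, hT₂, mul_one]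
  refine ⟨by omega, by omega, by omega, by omega, by omega, by omega, by omega, by omega, by omega,
    by omega, by omega, by omega, by omega, by omega, by omega, by omega, by omega, by omega,
    by omega, by omega, by omega, by omega, ?_⟩
  obtain ⟨m₃, hm₃⟩ : ∃ m₃, m₃ = Function.update (Function.update (Function.update (Function.update
    (Function.update (Function.update (Function.update m₂ rCur (heap + n)) (heap + n) n) rX
    (heap + n + 1)) rT heap) (heap + n + 1) heap) rT 3) rTop (heap + n + 3) := ⟨_, rfl⟩
  rw [← hm₃]
  have c0 : m₃ (heap + n) = n := by
    simp (disch := omega) only [hm₃, Function.update_self, Function.update_of_ne]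
  have c1 : m₃ (heap + n + 1) = heap := by
    simp (disch := omega) only [hm₃, Function.update_self, Function.update_of_ne]
  have c2 : ∀ i < n, m₃ (heap + i) = i := fun i hi => by
    simp (disch := omega) only [hm₃, Function.update_of_ne, harr₂]
  refine reaches_mainLoop hn hA hw
    (by simp (disch := omega) only [hm₃, Function.update_of_ne, b0])
    (by simp (disch := omega) only [hm₃, Function.update_of_ne, b1])
    (by simp (disch := omega) only [hm₃, Function.update_of_ne, b2])
    (by simp (disch := omega) only [hm₃, Function.update_self, Function.update_of_ne])
    (by simp (disch := omega) only [hm₃, Function.update_self])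
    (Layout.init hn c0 c1) ?_
  intro m₄ t₄ q₄ c d0 d1 hc hl hcons ht₄ hq₄
  simp only [d0]
  have hh : ∀ a, heap ≤ a →
      Function.update (Function.update m₄ rT heap) rN (n + heap) a = m₄ a := fun a ha => by
    simp (disch := omega) only [Function.update_of_ne]
  refine ⟨by omega, by omega, by omega, by omega, by omega, by omega,
    hQ _ _ _ c ?_ hc (hl.congr fun a ha => hh a (by omega)) (fun T bad hT hR =>
      (hcons T bad hT hR (Consistent.init hT hn c0 c1 c2)).congr hl hh) (by omega) hq₄⟩
  rw [Function.update_self, add_comm]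

/-- The first ten steps set the number of words in use to its final value; they are evaluated one by
one. -/
theorem runFrom_clusterCmd (hw : 8 * n + heap < 2 ^ w) : ∃ m : ℕ → ℕ, m rN = n ∧
    ∀ u, runFrom w O (u + 10) (Config.init clusterCmd n) =
      runFrom w O u ⟨[mainCmd], m, 0, 8 * n + 33⟩ := by
  obtain ⟨s, hs, h1, h2, h3, h4⟩ : ∃ s : Config, (∀ u,
      runFrom w O (u + 10) (Config.init clusterCmd n) = runFrom w O u s) ∧ s.todo = [mainCmd] ∧
      s.mem rN = n ∧ s.queries = 0 ∧ s.space = 8 * n + 33 := by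
    have e8 : 8 % 2 ^ w = 8 := Nat.mod_eq_of_lt (by omega)
    have e32 : heap % 2 ^ w = heap := Nat.mod_eq_of_lt (by omega)
    have en : 8 * n % 2 ^ w = 8 * n := Nat.mod_eq_of_lt (by omega)
    have en' : (8 * n + heap) % 2 ^ w = 8 * n + heap := Nat.mod_eq_of_lt hw
    have hstep : ∀ {k : ℕ} {s s₁ : Config} {R : Config → Prop}, step w O s = PMF.pure s₁ →
        (∃ s', (∀ u, runFrom w O (u + k) s₁ = runFrom w O u s') ∧ R s') →
        ∃ s', (∀ u, runFrom w O (u + (k + 1)) s = runFrom w O u s') ∧ R s' := by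
      rintro k s s₁ R h ⟨s', h1, h2⟩
      exact ⟨s', fun u => (runFrom_succ_pure h (u + k)).trans (h1 u), h2⟩
    iterate 10 refine hstep rfl ?_
    refine ⟨_, fun u => rfl, ?_⟩
    simp only [Config.write, Config.goto, Config.init, Arith.eval, List.foldr]
    simp (disch := omega) only [Function.update_self, Function.update_of_ne, e8, e32, en, en']
    refine ⟨rfl, trivial, trivial, by omega⟩
  obtain ⟨K, m, q, A⟩ := s
  simp only at h1 h2 h3 h4
  subst h1 h3 h4
  exact ⟨m, h2, hs⟩

/-- The factor `20` in the word size makes the constant `30000` fit into a word even for `n = 2`. -/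
theorem lt_two_pow_wordSize {n : ℕ} (hn : 2 ≤ n) : 30000 * (n + 1) < 2 ^ wordSize 20 n := by
  have h1 : n < 2 ^ (Nat.log 2 n + 1) := Nat.lt_pow_succ_log_self (by norm_num) n
  have h2 : (2 : ℕ) ^ 19 ≤ 2 ^ (19 * (Nat.log 2 n + 1)) :=
    Nat.pow_le_pow_right (by norm_num) (by omega)
  have h3 : 2 ^ wordSize 20 n = 2 ^ (19 * (Nat.log 2 n + 1)) * 2 ^ (Nat.log 2 n + 1) := by
    rw [wordSize, ← pow_add]
    congr 1
    ring
  rw [h3]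
  have := Nat.mul_le_mul h2 h1
  omega

/-- For every oracle the program reaches one and the same configuration for all outcomes of the
coins; if the oracle is reliable, then this configuration stores a strongly consistent tree. -/
theorem exists_run_eq_pure {n : ℕ} (hn : 2 ≤ n) (O : Oracle n) : ∃ s : Config,
    (∀ N, 300 * n ^ 3 ≤ N → run clusterCmd 20 O N = PMF.pure s) ∧ s.Halted ∧
    s.queries ≤ 4 * n ^ 3 ∧ s.space = 8 * n + 33 ∧
    ∀ T bad, T.IsHCTree → Reliable O T bad →
      ∃ I : ClusterTree n, s.Outputs I ∧ I.IsPartialHCTree ∧ I.StronglyConsistent T := by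
  have hw := lt_two_pow_wordSize hn
  obtain ⟨m, hm, hstart⟩ := runFrom_clusterCmd (w := wordSize 20 n) (O := O) (by omega)
  obtain ⟨m', t', q', ⟨c, d0, hc, hl, hcons, ht, hq⟩, hrun⟩ := reaches_mainCmd (w := wordSize 20 n)
    (A := 8 * n + 33) (O := O) (m := m) (t := 0) (q := 0)
    (Q := fun m' t' q' => ∃ c, m' rN = heap + n ∧ 0 < c ∧ Layout n m' c ∧
      (∀ T bad, T.IsHCTree → Reliable O T bad → Consistent T m' c c) ∧
      t' ≤ 2 * n * (2 * (n * (12 * n + 40)) + 120) + 11 * n + 100 ∧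
      q' ≤ 2 * n * (2 * (n * n))) hn rfl (by omega) (by omega) hm
    (fun m' t' q' c h1 h2 h3 h4 h5 h6 => ⟨c, h1, h2, h3, h4, by simpa using h5, by simpa using h6⟩)
  have hbound : 2 * n * (2 * (n * (12 * n + 40)) + 120) + 11 * n + 110 ≤ 300 * n ^ 3 := by
    obtain ⟨k, rfl⟩ := Nat.exists_eq_add_of_le hn
    ring_nf
    nlinarith [Nat.zero_le k, Nat.zero_le (k ^ 2), Nat.zero_le (k ^ 3)]
  have hcn := hl.count_le
  refine ⟨⟨[], m', q', 8 * n + 33⟩, fun N hN => ?_, rfl, ?_, rfl, fun T bad hT hR => ?_⟩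
  · obtain ⟨u, rfl⟩ : ∃ u, N = t' + u + 10 := ⟨N - 10 - t', by omega⟩
    rw [run, hstart, hrun, runFrom_of_todo_nil rfl]
  · refine hq.trans (le_of_eq ?_)
    ring
  · obtain ⟨I, hI1, hI2, hI3⟩ := (hcons T bad hT hR).exists_stores (A := 8 * n + 33) hl
      (by omega) hc
    refine ⟨I, ⟨rfl, ?_⟩, ⟨hI2.laminar hT.1, hI2.verts_eq.trans hT.2.1, fun X hX => Or.inr ?_⟩,
      hI2.stronglyConsistent hT.1⟩
    · simp only
      rwa [d0]
    · exact (Nat.cast_le.2 (hI3 X hX)).trans (threshold_le hn)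

end

end HC

theorem mainTheorem4 :
    ∃ (prog : Cmd) (κ : ℕ) (C : ℝ), 1 ≤ κ ∧ ∀ n : ℕ, 2 ≤ n →
      -- time, queries and space (in bits), for every oracle and for all outcomes of the coins
      (∀ O : Oracle n, ∀ s ∈ (run prog κ O ⌊C * ((n : ℝ) ^ 3 * Real.log n)⌋₊).support,
        s.Halted ∧
        (s.queries : ℝ) ≤ C * (n : ℝ) ^ 3 ∧
        ((s.space * wordSize κ n : ℕ) : ℝ) ≤ C * (n * Real.log n)) ∧
      -- correctness with high probability over the oracle and the coins
      (∀ T : ClusterTree n, T.IsHCTree →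
        ∀ (Ω : Type*) [MeasurableSpace Ω] (P : Measure Ω) [IsProbabilityMeasure P]
          (O : Ω → Oracle n), IsSplittingOracle P O T (9 / 10) →
          1 - 1 / (n : ℝ≥0∞) ≤
            ∫⁻ ω, (run prog κ (O ω) ⌊C * ((n : ℝ) ^ 3 * Real.log n)⌋₊).toOuterMeasure
              {s | ∃ I : ClusterTree n,
                s.Outputs I ∧ I.IsPartialHCTree ∧ I.StronglyConsistent T} ∂P) := by
  refine ⟨clusterCmd, 20, 2000, by norm_num, fun n hn => ?_⟩
  have hn2 : (2 : ℝ) ≤ n := by exact_mod_cast hn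
  have hlog2 := Real.log_two_gt_d9
  have hlog : Real.log 2 ≤ Real.log n := Real.log_le_log (by norm_num) hn2
  have htime : 300 * n ^ 3 ≤ ⌊(2000 : ℝ) * ((n : ℝ) ^ 3 * Real.log n)⌋₊ := by
    refine Nat.le_floor ?_
    push_cast
    have h3 : (0 : ℝ) ≤ (n : ℝ) ^ 3 := by positivity
    nlinarith [mul_le_mul_of_nonneg_left (hlog2.le.trans hlog) h3]
  refine ⟨fun O s hs => ?_, fun T hT Ω _ P _ O hO => ?_⟩
  · obtain ⟨s', hrun, hhalt, hq, hsp, -⟩ := exists_run_eq_pure hn O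
    rw [hrun _ htime, PMF.support_pure, Set.mem_singleton_iff] at hs
    subst hs
    refine ⟨hhalt, ?_, ?_⟩
    · have : (s.queries : ℝ) ≤ 4 * (n : ℝ) ^ 3 := by exact_mod_cast hq
      have h3 : (0 : ℝ) ≤ (n : ℝ) ^ 3 := by positivity
      linarith
    · have hL : (Nat.log 2 n : ℝ) * Real.log 2 ≤ Real.log n := by
        rw [← Real.log_pow]
        exact Real.log_le_log (by positivity)
          (by exact_mod_cast Nat.pow_log_le_self 2 (by omega))
      have hL1 : (1 : ℝ) ≤ Nat.log 2 n := by
        exact_mod_cast Nat.log_pos (by norm_num) hn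
      have hword : (Nat.log 2 n : ℝ) + 1 ≤ 3 * Real.log n := by nlinarith
      rw [hsp, wordSize]
      push_cast
      have h4 : (8 * (n : ℝ) + 33) ≤ 25 * n := by linarith
      calc (8 * (n : ℝ) + 33) * (20 * ((Nat.log 2 n : ℝ) + 1))
          ≤ (25 * n) * (20 * (3 * Real.log n)) := by gcongr
        _ ≤ 2000 * (n * Real.log n) := by
          have : (0 : ℝ) ≤ n * Real.log n := by positivity
          linarith
  · obtain ⟨G, hG, hPG, hrel⟩ := hO.exists_reliable hn
    refine hPG.trans ?_
    rw [← lintegral_indicator_one hG]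
    refine lintegral_mono fun ω => ?_
    by_cases hω : ω ∈ G
    · obtain ⟨bad, hR⟩ := hrel ω hω
      obtain ⟨s, hrun, -, -, -, hout⟩ := exists_run_eq_pure hn (O ω)
      rw [hrun _ htime, PMF.toOuterMeasure_pure_apply,
        if_pos (Set.mem_ofPred_eq ▸ hout T bad hT hR)]
      simp [hω]
    · simp [hω]
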